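/- Let $d \ge 3$ be an integer, let $T_d$ be the $d$-regular tree (the infinite connected graph without cycles in which every vertex has exactly $d$ neighbours) and let $M$ be a finite set. Let $Z=(Z_v)_{v\in V(T_d)}$ be independent random variables, each uniform on $[0,1]$, let $F\colon [0,1]^{V(T_d)}\to M^{V(T_d)}$ be a measurable map (for the product $\sigma$-algebras) that commutes with the natural actions $(\gamma\cdot f)(v)=f(\gamma^{-1}v)$ of the full automorphism group $\mathrm{Aut}(T_d)$, and let $Y=F(Z)$; such a $Y$ is called an $\mathrm{Aut}(T_d)$-factor of IID process. For a finite set $S\subset V(T_d)$ let $H(S)$ denote the Shannon entropy of the joint distribution of $(Y_v)_{v\in S}$. Then for the vertex set $P_3$ of any path with three edges (four distinct vertices) in $T_d$ and for the two endpoints $u,v$ of any edge of $T_d$, $$H(P_3)\ \ge\ \frac{2d-3}{d-1}\,H(\{u,v\}).$$ (By $\mathrm{Aut}(T_d)$-invariance of the distribution of $Y$, neither side depends on the choice of the path or of the edge.) -/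

import Mathlib

open MeasureTheory

/-- The natural action of the automorphisms of a graph `T` on vertex labellings:
`(γ · f)(v) = f (γ⁻¹ v)`. -/
def autAct {V : Type*} {T : SimpleGraph V} {A : Type*} (γ : T ≃g T) (f : V → A) : V → A :=
  fun v => f (γ.symm v)

/-- An `Aut(T)`-factor map: a measurable map between spaces of labellings (with their product
σ-algebras) that commutes with the action of every automorphism of `T`. -/
structure IsAutFactor {V : Type*} (T : SimpleGraph V) {A B : Type*}
    [MeasurableSpace A] [MeasurableSpace B] (F : (V → A) → (V → B)) : Prop where
  measurable : Measurable F
  equivariant : ∀ (γ : T ≃g T) (z : V → A), F (autAct γ z) = autAct γ (F z)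

/-- The law of a family of independent uniform `[0,1]` labels on the elements of `V`. -/
noncomputable def uniformIID (V : Type*) : Measure (V → unitInterval) :=
  Measure.infinitePi fun _ => (volume : Measure unitInterval)

/-- `μ` is (the law of) an `Aut(T)`-factor of IID process with state space `M`: it is the law of
`F(Z)` for some `Aut(T)`-factor map `F` and IID uniform `[0,1]` labels `Z` on the vertices. -/
def IsFactorOfIID {V : Type*} (T : SimpleGraph V) {M : Type*} [MeasurableSpace M]
    (μ : Measure (V → M)) : Prop :=
  ∃ F : (V → unitInterval) → (V → M), IsAutFactor T F ∧ μ = (uniformIID V).map F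

/-- Shannon entropy (natural logarithm) of a probability distribution on a finite set. -/
noncomputable def shannonEntropy {α : Type*} [Fintype α] [MeasurableSpace α]
    (ν : Measure α) : ℝ :=
  ∑ a, Real.negMulLog (ν.real {a})

open Classical in
/-- The entropy `H(S)` of the joint distribution of the states `Y_v`, `v ∈ S`, where the process
`Y` has law `μ`. -/
noncomputable def jointEntropy {V M : Type*} [Fintype M] [MeasurableSpace M]
    (μ : Measure (V → M)) (S : Finset V) : ℝ :=
  shannonEntropy (μ.map fun (y : V → M) (s : S) => y s)

section FreeGroupCount

open scoped Pointwise

variable {ι : Type*} [DecidableEq ι]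

theorem FreeGroup.toWord_eq_cons_of_norm_mk_mul_le (l : ι × Bool) (b : FreeGroup ι)
    (h : (FreeGroup.mk [l] * b).norm ≤ b.norm) : ∃ t, b.toWord = (l.1, !l.2) :: t := by
  have key : (FreeGroup.mk [l] * b).toWord = FreeGroup.reduce (l :: b.toWord) := by
    conv_lhs => rw [← FreeGroup.mk_toWord (x := b)]
    rw [FreeGroup.mul_mk, FreeGroup.toWord_mk]
    rfl
  rw [FreeGroup.norm, FreeGroup.norm, key, FreeGroup.reduce.cons, FreeGroup.reduce_toWord] at h
  cases hb : b.toWord with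
  | nil => simp [hb] at h
  | cons a t =>
    rw [hb] at h
    by_cases hc : l.1 = a.1 ∧ l.2 = !a.2
    · exact ⟨t, by rw [hc.1, hc.2]; simp⟩
    · simp only [hc, if_false] at h
      simp at h

theorem FreeGroup.eq_of_norm_mk_mul_le {l l' : ι × Bool} {b : FreeGroup ι}
    (h : (FreeGroup.mk [l] * b).norm ≤ b.norm) (h' : (FreeGroup.mk [l'] * b).norm ≤ b.norm) :
    l = l' := by
  obtain ⟨t, ht⟩ := FreeGroup.toWord_eq_cons_of_norm_mk_mul_le l b h
  obtain ⟨t', ht'⟩ := FreeGroup.toWord_eq_cons_of_norm_mk_mul_le l' b h'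
  rw [ht] at ht'
  simp only [List.cons.injEq, Prod.mk.injEq] at ht'
  exact Prod.ext ht'.1.1 (by simpa using ht'.1.2)

/-- The Cayley graph of a free group is a forest: a finite set spans fewer edges than it has
elements. -/
theorem FreeGroup.sum_card_filter_le [Fintype ι] (B : Finset (FreeGroup ι)) :
    ∑ i, (B.filter fun x => FreeGroup.of i * x ∈ B).card ≤ B.card - 1 := by
  classical
  refine Finset.induction_on_max_value FreeGroup.norm B (by simp) ?_
  · intro b B hb hmax ih
    let δ : Finset (ι × Bool) := Finset.univ.filter fun l => FreeGroup.mk [l] * b ∈ B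
    have hδ1 : δ.card ≤ 1 := by
      rw [Finset.card_le_one]
      intro l hl l' hl'
      simp only [δ, Finset.mem_filter, Finset.mem_univ, true_and] at hl hl'
      exact FreeGroup.eq_of_norm_mk_mul_le (hmax _ hl) (hmax _ hl')
    have hδsum : δ.card = ∑ i, ((if FreeGroup.of i * b ∈ B then 1 else 0) +
        (if (FreeGroup.of i)⁻¹ * b ∈ B then 1 else 0)) := by
      simp only [δ, Finset.card_filter, Fintype.sum_prod_type, Fintype.sum_bool]
      rfl
    have hstep : ∀ i, ((insert b B).filter fun x => FreeGroup.of i * x ∈ insert b B).card ≤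
        (B.filter fun x => FreeGroup.of i * x ∈ B).card +
        ((if FreeGroup.of i * b ∈ B then 1 else 0) +
        (if (FreeGroup.of i)⁻¹ * b ∈ B then 1 else 0)) := by
      intro i
      have hsub : ((insert b B).filter fun x => FreeGroup.of i * x ∈ insert b B) ⊆
          (B.filter fun x => FreeGroup.of i * x ∈ B) ∪
          ((if FreeGroup.of i * b ∈ B then {b} else ∅) ∪
          (if (FreeGroup.of i)⁻¹ * b ∈ B then {(FreeGroup.of i)⁻¹ * b} else ∅)) := by
        intro x hx
        simp only [Finset.mem_filter, Finset.mem_insert] at hx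
        simp only [Finset.mem_union, Finset.mem_filter]
        rcases hx with ⟨rfl | hx, h2 | h2⟩
        · exact absurd h2 (by simp)
        · right; left; simp [h2]
        · right; right
          have : x = (FreeGroup.of i)⁻¹ * b := by rw [← h2]; group
          rw [← this]; simp [hx]
        · left; exact ⟨hx, h2⟩
      refine (Finset.card_le_card hsub).trans ((Finset.card_union_le _ _).trans ?_)
      gcongr
      refine (Finset.card_union_le _ _).trans ?_
      gcongr <;> split_ifs <;> simp
    have hsum := Finset.sum_le_sum fun i (_ : i ∈ Finset.univ) => hstep i
    rw [Finset.sum_add_distrib, ← hδsum] at hsum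
    rw [Finset.card_insert_of_notMem hb]
    rcases B.eq_empty_or_nonempty with rfl | hB
    · have : δ.card = 0 := by simp [δ]
      simp only [Finset.card_empty] at ih ⊢
      omega
    · have := hB.card_pos
      omega

theorem FreeGroup.sum_card_union_smul_ge [Fintype ι] (B : Finset (FreeGroup ι))
    (hB : B.Nonempty) :
    2 * Fintype.card ι * B.card + 1 ≤ ∑ i : ι, (B ∪ FreeGroup.of i • B).card + B.card := by
  have h1 : ∀ i : ι, (B ∪ FreeGroup.of i • B).card +
      (B.filter fun x => FreeGroup.of i * x ∈ B).card = 2 * B.card := by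
    intro i
    have h2 : (B.filter fun x => FreeGroup.of i * x ∈ B).card =
        (B ∩ FreeGroup.of i • B).card := by
      rw [← Finset.card_smul_finset (FreeGroup.of i)]
      congr 1
      ext x
      simp only [Finset.mem_smul_finset, Finset.mem_filter, Finset.mem_inter, smul_eq_mul]
      constructor
      · rintro ⟨y, ⟨hy, hy'⟩, rfl⟩
        exact ⟨hy', y, hy, rfl⟩
      · rintro ⟨hx, y, hy, rfl⟩
        exact ⟨y, ⟨hy, hx⟩, rfl⟩
    rw [h2, Finset.card_union_add_card_inter, Finset.card_smul_finset, two_mul]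
  have h3 := FreeGroup.sum_card_filter_le B
  have h4 := Finset.sum_congr rfl fun i (_ : i ∈ Finset.univ) => h1 i
  rw [Finset.sum_add_distrib, Finset.sum_const, Finset.card_univ, smul_eq_mul] at h4
  have := hB.card_pos
  have h5 : Fintype.card ι * (2 * B.card) = 2 * Fintype.card ι * B.card := by ring
  omega

end FreeGroupCount

section InvariantSubmodular

open scoped Pointwise

variable {ι : Type*} [DecidableEq ι]

/-- A monotone, submodular, left-invariant function of pairs of finite subsets of a free group,
which is additive in the second argument on its own, and for which some finite second argument
determines the first argument `{1}`. -/
structure IsFiniteFactorEntropy (f : Finset (FreeGroup ι) → Finset (FreeGroup ι) → ℝ)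
    (h : ℝ) : Prop where
  mono : ∀ {S S' C C'}, S ⊆ S' → C ⊆ C' → f S C ≤ f S' C'
  submod : ∀ S S' C C', f (S ∪ S') (C ∪ C') + f (S ∩ S') (C ∩ C') ≤ f S C + f S' C'
  inv : ∀ (g : FreeGroup ι) (S C : Finset (FreeGroup ι)), f (g • S) (g • C) = f S C
  empty_left : ∀ C, f ∅ C = C.card * h
  determined : ∃ C₀, ∀ C, C₀ ⊆ C → f {1} C ≤ f ∅ C

namespace IsFiniteFactorEntropy

variable {f : Finset (FreeGroup ι) → Finset (FreeGroup ι) → ℝ} {h : ℝ}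

theorem nonneg (hf : IsFiniteFactorEntropy f h) : 0 ≤ h := by
  have h0 := hf.empty_left ∅
  have h1 := hf.empty_left {1}
  have := hf.mono (S := ∅) (S' := ∅) (C := ∅) (C' := {1}) (by simp) (by simp)
  simp only [Finset.card_empty, Finset.card_singleton, Nat.cast_zero, Nat.cast_one] at h0 h1
  linarith

theorem sub_le_sub (hf : IsFiniteFactorEntropy f h) {S S' C C' D : Finset (FreeGroup ι)}
    (hS : S ⊆ S') (hC : C ⊆ C') : f S' (C' ∪ D) - f S' C' ≤ f S (C ∪ D) - f S C := by
  have h1 := hf.submod S' S C' (C ∪ D)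
  have h2 : S' ∪ S = S' := Finset.union_eq_left.mpr hS
  have h3 : C' ∪ (C ∪ D) = C' ∪ D := by
    rw [← Finset.union_assoc, Finset.union_eq_left.mpr hC]
  rw [h2, h3] at h1
  have h4 : f S C ≤ f (S' ∩ S) (C' ∩ (C ∪ D)) :=
    hf.mono (Finset.subset_inter hS subset_rfl)
      (Finset.subset_inter hC Finset.subset_union_left)
  linarith

theorem sub_le_sub_smul (hf : IsFiniteFactorEntropy f h) {S S' C C' D : Finset (FreeGroup ι)}
    (g : FreeGroup ι) (hS : g • S ⊆ S') (hC : g • C ⊆ C') :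
    f S' (C' ∪ g • D) - f S' C' ≤ f S (C ∪ D) - f S C := by
  have := hf.sub_le_sub (D := g • D) hS hC
  rwa [← Finset.smul_finset_union, hf.inv, hf.inv] at this

theorem edge_le_add_two (hf : IsFiniteFactorEntropy f h) (C D : Finset (FreeGroup ι)) (i : ι) :
    f {1, FreeGroup.of i} ((C ∪ D) ∪ FreeGroup.of i • (C ∪ D)) ≤
      f {1, FreeGroup.of i} (C ∪ FreeGroup.of i • C) + 2 * (f {1} (C ∪ D) - f {1} C) := by
  have h1 := hf.sub_le_sub (S := {1}) (S' := {1, FreeGroup.of i}) (C := C)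
    (C' := C ∪ FreeGroup.of i • C) (D := D) (by simp) Finset.subset_union_left
  have h2 := hf.sub_le_sub_smul (S := {1}) (S' := {1, FreeGroup.of i}) (C := C)
    (C' := C ∪ FreeGroup.of i • C ∪ D) (D := D) (FreeGroup.of i) (by simp)
    (Finset.subset_union_right.trans Finset.subset_union_left)
  have h3 : (C ∪ D) ∪ FreeGroup.of i • (C ∪ D) =
      C ∪ FreeGroup.of i • C ∪ D ∪ FreeGroup.of i • D := by
    rw [Finset.smul_finset_union]; ext x; simp only [Finset.mem_union]; tauto
  rw [h3]
  linarith

variable [Fintype ι]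

/-- The edge-vertex functional of the process refined by the labels in `C`. -/
def edgeVertex (f : Finset (FreeGroup ι) → Finset (FreeGroup ι) → ℝ)
    (C : Finset (FreeGroup ι)) : ℝ :=
  ∑ i, f {1, FreeGroup.of i} (C ∪ FreeGroup.of i • C) - (2 * Fintype.card ι - 1) * f {1} C

theorem edgeVertex_singleton_le (hf : IsFiniteFactorEntropy f h) :
    edgeVertex f {1} ≤ edgeVertex f ∅ + h := by
  have h1 : ∀ i : ι, f {1, FreeGroup.of i} ({1} ∪ FreeGroup.of i • {1}) ≤
      f {1, FreeGroup.of i} (∅ ∪ FreeGroup.of i • ∅) + 2 * (f {1} {1} - f {1} ∅) := by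
    intro i
    simpa using hf.edge_le_add_two ∅ {1} i
  have h2 := Finset.sum_le_sum fun i (_ : i ∈ Finset.univ) => h1 i
  rw [Finset.sum_add_distrib, Finset.sum_const, Finset.card_univ, nsmul_eq_mul] at h2
  have h3 := hf.sub_le_sub (S := ∅) (S' := {1}) (C := ∅) (C' := ∅) (D := {1})
    (by simp) (by simp)
  simp only [Finset.empty_union, hf.empty_left, Finset.card_singleton, Finset.card_empty] at h3
  unfold edgeVertex
  push_cast at h3
  linarith

theorem edgeVertex_union_le (hf : IsFiniteFactorEntropy f h) (C D : Finset (FreeGroup ι)) (s : ι)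
    (hs : f {1, FreeGroup.of s} ((C ∪ D) ∪ FreeGroup.of s • (C ∪ D)) ≤
      f {1, FreeGroup.of s} (C ∪ FreeGroup.of s • C) + (f {1} (C ∪ D) - f {1} C)) :
    edgeVertex f (C ∪ D) ≤ edgeVertex f C := by
  have h1 : ∑ i ∈ Finset.univ.erase s, f {1, FreeGroup.of i} ((C ∪ D) ∪ FreeGroup.of i • (C ∪ D))
      ≤ ∑ i ∈ Finset.univ.erase s, (f {1, FreeGroup.of i} (C ∪ FreeGroup.of i • C) +
        2 * (f {1} (C ∪ D) - f {1} C)) :=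
    Finset.sum_le_sum fun i _ => hf.edge_le_add_two C D i
  have hcard : ((Finset.univ.erase s).card : ℝ) = Fintype.card ι - 1 := by
    rw [Finset.card_erase_of_mem (Finset.mem_univ s), Finset.card_univ, Nat.cast_sub]
    · simp
    · exact Fintype.card_pos_iff.mpr ⟨s⟩
  rw [Finset.sum_add_distrib, Finset.sum_const, nsmul_eq_mul, hcard] at h1
  unfold edgeVertex
  rw [← Finset.add_sum_erase _ _ (Finset.mem_univ s),
    ← Finset.add_sum_erase (f := fun i => f {1, FreeGroup.of i} (C ∪ FreeGroup.of i • C)) _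
      (Finset.mem_univ s)]
  linarith

theorem edgeVertex_insert_le (hf : IsFiniteFactorEntropy f h) (C : Finset (FreeGroup ι))
    (l : ι × Bool) {c : FreeGroup ι} (hc : c ∈ C) :
    edgeVertex f (C ∪ {FreeGroup.mk [l] * c}) ≤ edgeVertex f C := by
  obtain ⟨s, b⟩ := l
  refine hf.edgeVertex_union_le C _ s ?_
  cases b with
  | true =>
    change f _ ((C ∪ {FreeGroup.of s * c}) ∪ _ • (C ∪ {FreeGroup.of s * c})) ≤ _
    have h1 : (C ∪ {FreeGroup.of s * c}) ∪ FreeGroup.of s • (C ∪ {FreeGroup.of s * c}) =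
        (C ∪ FreeGroup.of s • C) ∪ FreeGroup.of s • {FreeGroup.of s * c} := by
      have : FreeGroup.of s * c ∈ FreeGroup.of s • C := Finset.smul_mem_smul_finset hc
      rw [Finset.smul_finset_union]
      ext x
      simp only [Finset.mem_union, Finset.mem_singleton]
      constructor
      · rintro ((h | rfl) | h | h) <;> tauto
      · tauto
    rw [h1]
    have := hf.sub_le_sub_smul (S := {1}) (S' := {1, FreeGroup.of s}) (C := C)
      (C' := C ∪ FreeGroup.of s • C) (D := {FreeGroup.of s * c}) (FreeGroup.of s) (by simp)
      Finset.subset_union_right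
    change _ ≤ _ + (f {1} (C ∪ {FreeGroup.of s * c}) - _)
    linarith
  | false =>
    change f _ ((C ∪ {(FreeGroup.of s)⁻¹ * c}) ∪ _ • (C ∪ {(FreeGroup.of s)⁻¹ * c})) ≤ _
    have h1 : (C ∪ {(FreeGroup.of s)⁻¹ * c}) ∪ FreeGroup.of s • (C ∪ {(FreeGroup.of s)⁻¹ * c}) =
        (C ∪ FreeGroup.of s • C) ∪ {(FreeGroup.of s)⁻¹ * c} := by
      rw [Finset.smul_finset_union, Finset.smul_finset_singleton, smul_eq_mul,
        mul_inv_cancel_left]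
      ext x
      simp only [Finset.mem_union, Finset.mem_singleton]
      constructor
      · rintro ((h | rfl) | h | rfl) <;> tauto
      · tauto
    rw [h1]
    have := hf.sub_le_sub (S := {1}) (S' := {1, FreeGroup.of s}) (C := C)
      (C' := C ∪ FreeGroup.of s • C) (D := {(FreeGroup.of s)⁻¹ * c}) (by simp)
      Finset.subset_union_left
    change _ ≤ _ + (f {1} (C ∪ {(FreeGroup.of s)⁻¹ * c}) - _)
    linarith

theorem exists_superset_mem (hf : IsFiniteFactorEntropy f h) (C : Finset (FreeGroup ι))
    (hC : 1 ∈ C) (L : List (ι × Bool)) :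
    ∃ C', C ⊆ C' ∧ FreeGroup.mk L ∈ C' ∧ edgeVertex f C' ≤ edgeVertex f C := by
  induction L with
  | nil => exact ⟨C, subset_rfl, hC, le_rfl⟩
  | cons l L ih =>
    obtain ⟨C', h1, h2, h3⟩ := ih
    refine ⟨C' ∪ {FreeGroup.mk [l] * FreeGroup.mk L}, h1.trans Finset.subset_union_left, ?_,
      (hf.edgeVertex_insert_le C' l h2).trans h3⟩
    rw [FreeGroup.mul_mk]
    simp

theorem exists_superset (hf : IsFiniteFactorEntropy f h) (C₀ : Finset (FreeGroup ι)) :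
    ∃ C, {1} ⊆ C ∧ C₀ ⊆ C ∧ edgeVertex f C ≤ edgeVertex f {1} := by
  induction C₀ using Finset.induction_on with
  | empty => exact ⟨{1}, subset_rfl, by simp, le_rfl⟩
  | insert a s _ ih =>
    obtain ⟨C, h1, h2, h3⟩ := ih
    obtain ⟨C', h4, h5, h6⟩ := hf.exists_superset_mem C (h1 (by simp)) a.toWord
    rw [FreeGroup.mk_toWord] at h5
    exact ⟨C', h1.trans h4, Finset.insert_subset h5 (h2.trans h4), h6.trans h3⟩

theorem edge_vertex_inequality (hf : IsFiniteFactorEntropy f h) :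
    (2 * Fintype.card ι - 1) * f {1} ∅ ≤ ∑ i, f {1, FreeGroup.of i} ∅ := by
  obtain ⟨C₀, hC₀⟩ := hf.determined
  obtain ⟨C, h1, h2, h3⟩ := hf.exists_superset C₀
  have hvert : f {1} C = C.card * h :=
    le_antisymm ((hC₀ C h2).trans_eq (hf.empty_left C))
      ((hf.empty_left C).symm.trans_le (hf.mono (by simp) subset_rfl))
  have hedge : ∀ i : ι, ((C ∪ FreeGroup.of i • C).card : ℝ) * h ≤
      f {1, FreeGroup.of i} (C ∪ FreeGroup.of i • C) := fun i =>
    (hf.empty_left _).symm.trans_le (hf.mono (by simp) subset_rfl)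
  have hsum := Finset.sum_le_sum fun i (_ : i ∈ Finset.univ) => hedge i
  rw [← Finset.sum_mul] at hsum
  have hcount : (2 * (Fintype.card ι : ℝ) * C.card + 1) ≤
      ∑ i : ι, ((C ∪ FreeGroup.of i • C).card : ℝ) + C.card := by
    exact_mod_cast FreeGroup.sum_card_union_smul_ge C ⟨1, h1 (by simp)⟩
  have hcount' := mul_le_mul_of_nonneg_right hcount hf.nonneg
  have h4 := hf.edgeVertex_singleton_le
  have h5 := edgeVertex.eq_1 f C
  have h6 := edgeVertex.eq_1 f ∅
  rw [h5, hvert] at h3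
  rw [h6] at h4
  simp only [Finset.smul_finset_empty, Finset.empty_union] at h4
  linarith

end IsFiniteFactorEntropy

end InvariantSubmodular

namespace SimpleGraph

variable {V : Type*} {T : SimpleGraph V}

theorem IsTree.eq_of_adj_of_dist_lt (hT : T.IsTree) {a v w w' : V} (hw : T.Adj v w)
    (hw' : T.Adj v w') (h : T.dist a w < T.dist a v) (h' : T.dist a w' < T.dist a v) :
    w = w' := by
  classical
  obtain ⟨p, hp, hpl⟩ := hT.connected.exists_path_of_dist v a
  have key : ∀ x, T.Adj v x → T.dist a x < T.dist a v → x = p.snd := by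
    intro x hx hlt
    obtain ⟨q, hq, hql⟩ := hT.connected.exists_path_of_dist x a
    refine hT.isAcyclic.eq_snd_of_adj_start hp hx ?_
    have hv : v ∉ q.support := by
      intro hv
      have h1 := (T.dist_le (q.dropUntil v hv)).trans (q.length_dropUntil_le_length hv)
      rw [hql, dist_comm, dist_comm (u := x)] at h1
      omega
    have : p = Walk.cons hx q := by
      have := (hT.isAcyclic.subsingleton_path v a).elim ⟨p, hp⟩ ⟨Walk.cons hx q, hq.cons hv⟩
      exact congrArg Subtype.val this
    rw [this]
    simp
  rw [key w hw h, key w' hw' h']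

/-- `S` is the graph of an isometry between two convex sets of vertices. -/
structure IsConvexIsometry (T : SimpleGraph V) (S : Set (V × V)) : Prop where
  dist_eq : ∀ p ∈ S, ∀ q ∈ S, T.dist p.1 q.1 = T.dist p.2 q.2
  convex : ∀ p ∈ S, ∀ q ∈ S, p ≠ q → ∃ r ∈ S, T.Adj r.1 p.1 ∧ T.dist r.1 q.1 + 1 = T.dist p.1 q.1

namespace IsConvexIsometry

variable {S : Set (V × V)}

theorem singleton (a b : V) : T.IsConvexIsometry {(a, b)} := by
  constructor
  · rintro p rfl q rfl; simp
  · rintro p rfl q rfl h; exact absurd rfl h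

theorem adj_iff (hS : T.IsConvexIsometry S) {p q : V × V} (hp : p ∈ S) (hq : q ∈ S) :
    T.Adj p.1 q.1 ↔ T.Adj p.2 q.2 := by
  rw [← dist_eq_one_iff_adj, ← dist_eq_one_iff_adj, hS.dist_eq p hp q hq]

theorem eq_iff (hT : T.Connected) (hS : T.IsConvexIsometry S) {p q : V × V} (hp : p ∈ S)
    (hq : q ∈ S) : p.1 = q.1 ↔ p.2 = q.2 := by
  rw [← hT.dist_eq_zero_iff, ← hT.dist_eq_zero_iff, hS.dist_eq p hp q hq]

theorem swap (hS : T.IsConvexIsometry S) : T.IsConvexIsometry (Prod.swap '' S) := by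
  constructor
  · rintro _ ⟨p, hp, rfl⟩ _ ⟨q, hq, rfl⟩
    exact (hS.dist_eq p hp q hq).symm
  · rintro _ ⟨p, hp, rfl⟩ _ ⟨q, hq, rfl⟩ hne
    obtain ⟨r, hr, h1, h2⟩ := hS.convex p hp q hq fun h => hne (h ▸ rfl)
    refine ⟨r.swap, ⟨r, hr, rfl⟩, (hS.adj_iff hr hp).mp h1, ?_⟩
    have h3 := hS.dist_eq r hr q hq
    have h4 := hS.dist_eq p hp q hq
    simp only [Prod.fst_swap]
    omega

theorem dist_insert (hT : T.IsTree) (hS : T.IsConvexIsometry S) {v v' w : V}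
    (hv : (v, v') ∈ S) (hw : T.Adj v w) (hwS : ∀ p ∈ S, p.1 ≠ w) {p : V × V} (hp : p ∈ S) :
    T.dist w p.1 = T.dist v p.1 + 1 := by
  rcases hT.dist_eq_dist_add_one_of_adj p.1 hw with h | h
  · exfalso
    have hne : (v, v') ≠ p := by
      rintro rfl
      simp at h
    obtain ⟨r, hr, h1, h2⟩ := hS.convex _ hv p hp hne
    change T.dist r.1 p.1 + 1 = T.dist v p.1 at h2
    rw [dist_comm, dist_comm (u := v)] at h2
    exact hwS r hr (hT.eq_of_adj_of_dist_lt (v := v) (a := p.1) h1.symm hw (by omega) (by omega))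
  · rw [dist_comm, h, dist_comm]

theorem insert (hT : T.IsTree) (hS : T.IsConvexIsometry S) {v v' w w' : V}
    (hv : (v, v') ∈ S) (hw : T.Adj v w) (hw' : T.Adj v' w') (hwS : ∀ p ∈ S, p.1 ≠ w)
    (hwS' : ∀ p ∈ S, p.2 ≠ w') : T.IsConvexIsometry (insert (w, w') S) := by
  have key1 : ∀ p ∈ S, T.dist w p.1 = T.dist v p.1 + 1 :=
    fun p hp => hS.dist_insert hT hv hw hwS hp
  have key2 : ∀ p ∈ S, T.dist w' p.2 = T.dist v' p.2 + 1 := by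
    intro p hp
    refine hS.swap.dist_insert hT (v := v') (v' := v) (p := p.swap) ⟨_, hv, rfl⟩ hw' ?_ ⟨_, hp, rfl⟩
    rintro _ ⟨q, hq, rfl⟩
    exact hwS' q hq
  have key3 : ∀ p ∈ S, T.dist w p.1 = T.dist w' p.2 := by
    intro p hp
    rw [key1 p hp, key2 p hp, hS.dist_eq _ hv p hp]
  constructor
  · rintro p (rfl | hp) q (rfl | hq)
    · simp
    · exact key3 q hq
    · rw [dist_comm, dist_comm (u := p.2)]; exact key3 p hp
    · exact hS.dist_eq p hp q hq
  · rintro p (rfl | hp) q (rfl | hq) hne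
    · exact absurd rfl hne
    · exact ⟨_, Or.inr hv, hw, (key1 q hq).symm⟩
    · by_cases hpv : p = (v, v')
      · subst hpv
        refine ⟨_, Or.inl rfl, hw.symm, ?_⟩
        simp [dist_eq_one_iff_adj.mpr hw]
      · obtain ⟨r, hr, h1, h2⟩ := hS.convex p hp _ hv hpv
        refine ⟨r, Or.inr hr, h1, ?_⟩
        have h3 := key1 r hr
        have h4 := key1 p hp
        rw [dist_comm (u := w), dist_comm (u := v)] at h3 h4
        simp only at h2 ⊢
        omega
    · obtain ⟨r, hr, h⟩ := hS.convex p hp q hq hne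
      exact ⟨r, Or.inr hr, h⟩

theorem exists_adj_notMem_range {d : ℕ} [T.LocallyFinite] (hreg : T.IsRegularOfDegree d)
    (hT : T.Connected) (hS : T.IsConvexIsometry S)
    {v v' w : V} (hv : (v, v') ∈ S) (hw : T.Adj v w) (hwS : ∀ p ∈ S, p.1 ≠ w) :
    ∃ w', T.Adj v' w' ∧ ∀ p ∈ S, p.2 ≠ w' := by
  classical
  by_contra! hcon
  choose! φ hφS hφ using hcon
  have hlt : (T.neighborFinset v').card < (T.neighborFinset v).card := by
    refine (Finset.card_le_card_of_injOn (fun x => (φ x).1)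
      (t := (T.neighborFinset v).erase w) ?_ ?_).trans_lt
      (Finset.card_erase_lt_of_mem ((T.mem_neighborFinset v w).mpr hw))
    · intro x hx
      have hx' : T.Adj v' x := by simpa using hx
      simp only [Finset.coe_erase, Set.mem_sdiff, Set.mem_singleton_iff, Finset.mem_coe,
        mem_neighborFinset]
      refine ⟨(hS.adj_iff hv (hφS x hx')).mpr ?_, hwS _ (hφS x hx')⟩
      rw [hφ x hx']
      exact hx'
    · intro x hx y hy hxy
      have hx' : T.Adj v' x := by simpa using hx
      have hy' : T.Adj v' y := by simpa using hy
      have := (hS.eq_iff hT (hφS x hx') (hφS y hy')).mp hxy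
      rwa [hφ x hx', hφ y hy'] at this
  rw [card_neighborFinset_eq_degree, card_neighborFinset_eq_degree, hreg v, hreg v'] at hlt
  exact lt_irrefl _ hlt

theorem exists_mem_fst_of_maximal {d : ℕ} [T.LocallyFinite] (hreg : T.IsRegularOfDegree d)
    (hT : T.IsTree) (hS : Maximal T.IsConvexIsometry S) (hne : S.Nonempty) (w : V) :
    ∃ p ∈ S, p.1 = w := by
  by_contra! hw
  obtain ⟨s, hs⟩ := hne
  obtain ⟨walk⟩ := hT.connected s.1 w
  obtain ⟨e, -, ⟨⟨v, v'⟩, hv, hve⟩, he2⟩ := walk.exists_boundary_dart (Prod.fst '' S) ⟨s, hs, rfl⟩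
    (by rintro ⟨p, hp, h⟩; exact hw p hp h)
  have hadj : T.Adj v e.snd := by
    have := e.adj
    rwa [← hve] at this
  have hnot : ∀ p ∈ S, p.1 ≠ e.snd := fun p hp h => he2 ⟨p, hp, h⟩
  obtain ⟨w', hw', hnot'⟩ := hS.prop.exists_adj_notMem_range hreg hT.connected hv hadj hnot
  have hins := hS.prop.insert hT hv hadj hw' hnot hnot'
  exact hnot _ (hS.le_of_ge hins (Set.subset_insert _ _) (Set.mem_insert _ _)) rfl

theorem exists_maximal (hS : T.IsConvexIsometry S) :
    ∃ S', S ⊆ S' ∧ Maximal T.IsConvexIsometry S' := by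
  refine zorn_le_nonempty₀ {S | T.IsConvexIsometry S} (fun c hc hchain y hy => ?_) S hS
  refine ⟨⋃₀ c, ?_, fun s hs => Set.subset_sUnion_of_mem hs⟩
  have hdir : ∀ p ∈ ⋃₀ c, ∀ q ∈ ⋃₀ c, ∃ s ∈ c, p ∈ s ∧ q ∈ s := by
    rintro p ⟨s, hs, hp⟩ q ⟨t, ht, hq⟩
    rcases hchain.total hs ht with h | h
    · exact ⟨t, ht, h hp, hq⟩
    · exact ⟨s, hs, hp, h hq⟩
  constructor
  · intro p hp q hq
    obtain ⟨s, hs, hp, hq⟩ := hdir p hp q hq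
    exact (hc hs).dist_eq p hp q hq
  · intro p hp q hq hne
    obtain ⟨s, hs, hp, hq⟩ := hdir p hp q hq
    obtain ⟨r, hr, h⟩ := (hc hs).convex p hp q hq hne
    exact ⟨r, ⟨s, hs, hr⟩, h⟩

/-- In a regular tree every isometry between convex sets extends to an automorphism. -/
theorem exists_iso {d : ℕ} [T.LocallyFinite] (hreg : T.IsRegularOfDegree d)
    (hT : T.IsTree) (hS : T.IsConvexIsometry S) (hne : S.Nonempty) :
    ∃ φ : T ≃g T, ∀ p ∈ S, φ p.1 = p.2 := by
  obtain ⟨S', hSS', hmax⟩ := hS.exists_maximal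
  have hne' : S'.Nonempty := hne.mono hSS'
  have hswap : Maximal T.IsConvexIsometry (Prod.swap '' S') := by
    refine ⟨hmax.prop.swap, fun R hR hle => ?_⟩
    have h1 : S' ≤ Prod.swap '' R := by
      intro p hp
      exact ⟨p.swap, hle ⟨p, hp, rfl⟩, by simp⟩
    rintro p hp
    exact ⟨p.swap, hmax.le_of_ge hR.swap h1 ⟨p, hp, rfl⟩, by simp⟩
  have hdom := exists_mem_fst_of_maximal hreg hT hmax hne'
  have hran := exists_mem_fst_of_maximal hreg hT hswap (hne'.image _)
  choose f hf hf1 using hdom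
  have hbij : Function.Bijective fun v => (f v).2 := by
    constructor
    · intro v w hvw
      have := (hmax.prop.eq_iff hT.connected (hf v) (hf w)).mpr hvw
      rwa [hf1, hf1] at this
    · intro w
      obtain ⟨_, ⟨p, hp, rfl⟩, hpw⟩ := hran w
      refine ⟨p.1, ?_⟩
      rw [Prod.fst_swap] at hpw
      rw [← hpw]
      exact (hmax.prop.eq_iff hT.connected (hf p.1) hp).mp (hf1 p.1)
  refine ⟨⟨Equiv.ofBijective _ hbij, ?_⟩, ?_⟩
  · intro v w
    have := hmax.prop.adj_iff (hf v) (hf w)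
    rw [hf1, hf1] at this
    exact this.symm
  · intro p hp
    exact (hmax.prop.eq_iff hT.connected (hf p.1) (hSS' hp)).mp (hf1 p.1)

end IsConvexIsometry

theorem IsTree.isConvexIsometry_path_two (hT : T.IsTree)
    {a₀ a₁ b₀ b₁ : V} (ha₀ : T.Adj a₀ a₁) (hb₀ : T.Adj b₀ b₁) :
    T.IsConvexIsometry {(a₁, b₁), (a₀, b₀)} := by
  refine (IsConvexIsometry.singleton a₀ b₀).insert hT rfl ha₀ hb₀ ?_ ?_
  · rintro p rfl; exact ha₀.ne
  · rintro p rfl; exact hb₀.ne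

variable {d : ℕ} [T.LocallyFinite]

/-- The automorphism group of a regular tree is transitive on arcs. -/
theorem IsTree.exists_iso_of_adj (hT : T.IsTree) (hreg : T.IsRegularOfDegree d)
    {a₀ a₁ b₀ b₁ : V} (ha₀ : T.Adj a₀ a₁) (hb₀ : T.Adj b₀ b₁) :
    ∃ φ : T ≃g T, φ a₀ = b₀ ∧ φ a₁ = b₁ := by
  obtain ⟨φ, hφ⟩ := (hT.isConvexIsometry_path_two ha₀ hb₀).exists_iso hreg hT
    (Set.insert_nonempty _ _)
  exact ⟨φ, hφ (a₀, b₀) (by simp), hφ (a₁, b₁) (by simp)⟩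

/-- The automorphism group of a regular tree is transitive on paths with three edges. -/
theorem IsTree.exists_iso_of_path_three (hT : T.IsTree) (hreg : T.IsRegularOfDegree d)
    {a₀ a₁ a₂ a₃ b₀ b₁ b₂ b₃ : V}
    (ha₀ : T.Adj a₀ a₁) (ha₁ : T.Adj a₁ a₂) (ha₂ : T.Adj a₂ a₃)
    (ha : [a₀, a₁, a₂, a₃].Nodup)
    (hb₀ : T.Adj b₀ b₁) (hb₁ : T.Adj b₁ b₂) (hb₂ : T.Adj b₂ b₃)
    (hb : [b₀, b₁, b₂, b₃].Nodup) :
    ∃ φ : T ≃g T, φ a₀ = b₀ ∧ φ a₁ = b₁ ∧ φ a₂ = b₂ ∧ φ a₃ = b₃ := by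
  simp only [List.nodup_cons, List.mem_cons, List.not_mem_nil, or_false, not_or] at ha hb
  have h2 := hT.isConvexIsometry_path_two ha₀ hb₀
  have h3 := h2.insert hT (w := a₂) (w' := b₂) (Set.mem_insert _ _) ha₁ hb₁
    (by rintro p (rfl | rfl) <;> simp_all) (by rintro p (rfl | rfl) <;> simp_all)
  have h4 := h3.insert hT (w := a₃) (w' := b₃) (Set.mem_insert _ _) ha₂ hb₂
    (by rintro p (rfl | rfl | rfl) <;> simp_all) (by rintro p (rfl | rfl | rfl) <;> simp_all)
  obtain ⟨φ, hφ⟩ := h4.exists_iso hreg hT (Set.insert_nonempty _ _)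
  exact ⟨φ, hφ (a₀, b₀) (by simp), hφ (a₁, b₁) (by simp), hφ (a₂, b₂) (by simp),
    hφ (a₃, b₃) (by simp)⟩

end SimpleGraph

namespace SimpleGraph

variable {V : Type*} {T : SimpleGraph V}

theorem Iso.dist_apply (φ : T ≃g T) (hT : T.Connected) (v w : V) :
    T.dist (φ v) (φ w) = T.dist v w := by
  have key : ∀ (ψ : T ≃g T) (a b : V), T.dist (ψ a) (ψ b) ≤ T.dist a b := by
    intro ψ a b
    obtain ⟨p, hp⟩ := hT.exists_walk_length_eq_dist a b
    rw [← hp, ← Walk.length_map (f := ψ.toHom)]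
    exact dist_le _
  refine le_antisymm (key φ v w) ?_
  simpa using key φ.symm (φ v) (φ w)

/-- The half-trees that play ping-pong: the vertices beyond the neighbour `x i` of `o`, and those
beyond the neighbour `y i` of `o'`. -/
def pingPongSet (T : SimpleGraph V) {ι : Type*} (o o' : V) (x y : ι → V) : ι × Bool → Set V
  | (i, true) => {v | T.dist v (x i) < T.dist v o}
  | (i, false) => {v | T.dist v (y i) < T.dist v o'}

section PingPong

variable {ι : Type*} {o o' : V} {x y : ι → V}

theorem IsTree.eq_of_mem_pingPongSet (hT : T.IsTree) (hoo' : T.Adj o o')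
    (hx : ∀ i, T.Adj o (x i)) (hx' : ∀ i, x i ≠ o') (hxinj : Function.Injective x)
    (hy : ∀ i, T.Adj o' (y i)) (hy' : ∀ i, y i ≠ o) (hyinj : Function.Injective y)
    {l l' : ι × Bool} {v : V} (hl : v ∈ T.pingPongSet o o' x y l)
    (hl' : v ∈ T.pingPongSet o o' x y l') : l = l' := by
  have mixed : ∀ i j, T.dist v (x i) < T.dist v o → ¬ T.dist v (y j) < T.dist v o' := by
    intro i j h1 h2
    rcases hT.dist_eq_dist_add_one_of_adj v hoo' with h | h
    · exact hx' i (hT.eq_of_adj_of_dist_lt (a := v) (hx i) hoo' h1 (by omega))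
    · exact hy' j (hT.eq_of_adj_of_dist_lt (a := v) (hy j) hoo'.symm h2 (by omega))
  obtain ⟨i, b⟩ := l
  obtain ⟨j, c⟩ := l'
  cases b <;> cases c <;> simp only [pingPongSet, Set.mem_ofPred_eq] at hl hl'
  · rw [hyinj (hT.eq_of_adj_of_dist_lt (hy i) (hy j) hl hl')]
  · exact absurd hl (mixed j i hl')
  · exact absurd hl' (mixed i j hl)
  · rw [hxinj (hT.eq_of_adj_of_dist_lt (hx i) (hx j) hl hl')]

theorem IsTree.notMem_pingPongSet (hT : T.IsTree) (hoo' : T.Adj o o')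
    (hx' : ∀ i, x i ≠ o') (hy' : ∀ i, y i ≠ o) (l : ι × Bool) (b : Bool) :
    (bif b then o' else o) ∉ T.pingPongSet o o' x y l := by
  have h1 := dist_eq_one_iff_adj.mpr hoo'
  have h2 := dist_eq_one_iff_adj.mpr hoo'.symm
  obtain ⟨i, c⟩ := l
  have h3 := hT.connected.pos_dist_of_ne (hx' i).symm
  have h4 := hT.connected.pos_dist_of_ne (hy' i).symm
  cases b <;> cases c <;> simp only [pingPongSet, Set.mem_ofPred_eq, cond_true, cond_false,
    dist_self] <;> omega

theorem IsTree.lift_mem_pingPongSet (hT : T.IsTree) {g : ι → (T ≃g T)}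
    (hx : ∀ i, T.Adj o (x i)) (hy : ∀ i, T.Adj o' (y i))
    (hgy : ∀ i, g i (y i) = o) (hgo' : ∀ i, g i o' = x i) {l : ι × Bool} {v : V}
    (hv : v ∉ T.pingPongSet o o' x y (l.1, !l.2)) :
    FreeGroup.lift g (FreeGroup.mk [l]) v ∈ T.pingPongSet o o' x y l := by
  obtain ⟨i, b⟩ := l
  cases b
  · have h1 : FreeGroup.lift g (FreeGroup.mk [(i, false)]) = (g i)⁻¹ := by
      simp [FreeGroup.lift_mk]
    rw [h1]
    simp only [pingPongSet, Set.mem_ofPred_eq, Bool.not_false] at hv ⊢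
    have h2 := hT.dist_eq_dist_add_one_of_adj v (hx i)
    rw [← (g i).dist_apply hT.connected, ← (g i).dist_apply hT.connected _ o', hgy, hgo',
      RelIso.apply_inv_self]
    omega
  · have h1 : FreeGroup.lift g (FreeGroup.mk [(i, true)]) = g i := by
      simp [FreeGroup.lift_mk]
    rw [h1]
    simp only [pingPongSet, Set.mem_ofPred_eq, Bool.not_true] at hv ⊢
    have h2 := hT.dist_eq_dist_add_one_of_adj v (hy i)
    rw [← hgy i, ← hgo' i, (g i).dist_apply hT.connected, (g i).dist_apply hT.connected]
    omega

end PingPong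

variable {d : ℕ} [T.LocallyFinite]

/-- In a `d`-regular tree, a free group of rank `d - 1` acts simply transitively on a perfect
matching which contains a given edge, each free generator moving that edge by distance one. -/
theorem IsTree.exists_freeGroup_action (hT : T.IsTree) (hreg : T.IsRegularOfDegree d) {o o' : V}
    (hoo' : T.Adj o o') :
    ∃ ρ : FreeGroup (Fin (d - 1)) →* (T ≃g T),
      (Function.Bijective fun p : FreeGroup (Fin (d - 1)) × Bool =>
        ρ p.1 (bif p.2 then o' else o)) ∧
      ∀ i, T.Adj o (ρ (FreeGroup.of i) o') := by
  classical
  have enum : ∀ {a b : V}, T.Adj a b → ∃ x : Fin (d - 1) → V, (∀ i, T.Adj a (x i)) ∧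
      (∀ i, x i ≠ b) ∧ Function.Injective x ∧ ∀ w, T.Adj a w → w ≠ b → ∃ i, x i = w := by
    intro a b hab
    have hcard : ((T.neighborFinset a).erase b).card = d - 1 := by
      rw [Finset.card_erase_of_mem ((T.mem_neighborFinset a b).mpr hab),
        card_neighborFinset_eq_degree, hreg a]
    let e := ((T.neighborFinset a).erase b).equivFinOfCardEq hcard
    have he : ∀ i, T.Adj a (e.symm i) ∧ ((e.symm i : V) ≠ b) := by
      intro i
      have := (e.symm i).2
      rw [Finset.mem_erase, mem_neighborFinset] at this
      exact this.symm
    refine ⟨fun i => e.symm i, fun i => (he i).1, fun i => (he i).2,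
      Subtype.val_injective.comp e.symm.injective, fun w hw hwb => ?_⟩
    exact ⟨e ⟨w, by rw [Finset.mem_erase, mem_neighborFinset]; exact ⟨hwb, hw⟩⟩, by simp⟩
  obtain ⟨x, hx, hx', hxinj, hxsurj⟩ := enum hoo'
  obtain ⟨y, hy, hy', hyinj, hysurj⟩ := enum hoo'.symm
  choose g hgy hgo' using fun i => hT.exists_iso_of_adj hreg (hy i).symm (hx i)
  let ρ := FreeGroup.lift g
  have hρof : ∀ i, ρ (FreeGroup.of i) = g i := fun i => FreeGroup.lift_apply_of
  have hmem : ∀ (L : List (Fin (d - 1) × Bool)) (l : Fin (d - 1) × Bool) (b : Bool),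
      FreeGroup.IsReduced (l :: L) →
        ρ (FreeGroup.mk (l :: L)) (bif b then o' else o) ∈ T.pingPongSet o o' x y l := by
    intro L
    induction L with
    | nil =>
      intro l b _
      exact hT.lift_mem_pingPongSet hx hy hgy hgo' (hT.notMem_pingPongSet hoo' hx' hy' _ _)
    | cons l' L ih =>
      intro l b hred
      rw [FreeGroup.isReduced_cons_cons] at hred
      have h1 := ih l' b hred.2
      have h2 : FreeGroup.mk (l :: l' :: L) = FreeGroup.mk [l] * FreeGroup.mk (l' :: L) := by
        rw [FreeGroup.mul_mk]; rfl
      rw [h2, map_mul, RelIso.mul_apply]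
      refine hT.lift_mem_pingPongSet hx hy hgy hgo' fun h3 => ?_
      have h4 := hT.eq_of_mem_pingPongSet hoo' hx hx' hxinj hy hy' hyinj h1 h3
      have h5 := hred.1 (by rw [h4])
      rw [h4] at h5
      simp at h5
  have hfree : ∀ (γ : FreeGroup (Fin (d - 1))) (b c : Bool),
      ρ γ (bif b then o' else o) = (bif c then o' else o) → γ = 1 := by
    intro γ b c h
    cases hL : γ.toWord with
    | nil => exact FreeGroup.toWord_eq_nil_iff.mp hL
    | cons l L =>
      exfalso
      have h1 := hmem L l b (hL ▸ FreeGroup.isReduced_toWord)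
      rw [← hL, FreeGroup.mk_toWord, h] at h1
      exact hT.notMem_pingPongSet hoo' hx' hy' _ _ h1
  refine ⟨ρ, ⟨?_, ?_⟩, ?_⟩
  · rintro ⟨γ, b⟩ ⟨γ', c⟩ h
    simp only at h
    have h1 : ρ (γ'⁻¹ * γ) (bif b then o' else o) = (bif c then o' else o) := by
      rw [map_mul, RelIso.mul_apply, h, map_inv, RelIso.inv_apply_self]
    have h2 := hfree _ _ _ h1
    rw [h2, map_one, RelIso.one_apply] at h1
    have h3 : γ = γ' := (inv_mul_eq_one.mp h2).symm
    have h4 : b = c := by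
      cases b <;> cases c <;> simp_all [hoo'.ne, hoo'.ne']
    rw [h3, h4]
  · by_contra hsurj
    simp only [Function.Surjective, not_forall] at hsurj
    obtain ⟨w, hw⟩ := hsurj
    obtain ⟨walk⟩ := hT.connected o w
    obtain ⟨e, -, ⟨⟨γ, b⟩, hγ⟩, he2⟩ := walk.exists_boundary_dart
      (Set.range fun p : FreeGroup (Fin (d - 1)) × Bool => ρ p.1 (bif p.2 then o' else o))
      ⟨(1, false), by simp⟩ hw
    simp only at hγ
    refine he2 ?_
    have hadj : T.Adj (bif b then o' else o) ((ρ γ)⁻¹ e.snd) := by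
      have := e.adj
      rw [← hγ, ← RelIso.apply_inv_self (ρ γ) e.snd] at this
      exact (ρ γ).map_adj_iff.mp this
    suffices h : ∃ (γ' : FreeGroup (Fin (d - 1))) (c : Bool),
        ρ γ' (bif c then o' else o) = (ρ γ)⁻¹ e.snd by
      obtain ⟨γ', c, h⟩ := h
      exact ⟨(γ * γ', c), by simp only [map_mul, RelIso.mul_apply, h, RelIso.apply_inv_self]⟩
    generalize (ρ γ)⁻¹ e.snd = z at hadj
    cases b
    · by_cases hz : z = o'
      · exact ⟨1, true, by simp [hz]⟩
      · obtain ⟨i, rfl⟩ := hxsurj z hadj hz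
        exact ⟨FreeGroup.of i, true, by rw [hρof, cond_true, hgo']⟩
    · by_cases hz : z = o
      · exact ⟨1, false, by simp [hz]⟩
      · obtain ⟨i, rfl⟩ := hysurj z hadj hz
        refine ⟨(FreeGroup.of i)⁻¹, false, ?_⟩
        rw [map_inv, hρof, cond_false, ← hgy i, RelIso.inv_apply_self]
  · intro i
    rw [hρof, hgo']
    exact hx i

end SimpleGraph

section Entropy

variable {Ω : Type*} [MeasurableSpace Ω] {α β γ δ : Type*}

/-- A function with measurable fibres. -/
def FiberMeasurable (X : Ω → α) : Prop := ∀ a, MeasurableSet (X ⁻¹' {a})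

theorem FiberMeasurable.of_factorsThrough [Finite α] {X : Ω → α} {Y : Ω → β}
    (hX : FiberMeasurable X) (hY : Y.FactorsThrough X) : FiberMeasurable Y := by
  intro b
  have : Y ⁻¹' {b} = ⋃ a ∈ {a | ∃ ω, X ω = a ∧ Y ω = b}, X ⁻¹' {a} := by
    ext ω
    simp only [Set.mem_preimage, Set.mem_singleton_iff, Set.mem_iUnion, exists_prop]
    constructor
    · intro h
      exact ⟨X ω, ⟨ω, rfl, h⟩, rfl⟩
    · rintro ⟨a, ⟨ω', h1, h2⟩, h3⟩
      rw [← h2]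
      exact hY (h3.trans h1.symm)
  rw [this]
  exact MeasurableSet.biUnion (Set.to_countable _) fun a _ => hX a

theorem FiberMeasurable.prodMk {X : Ω → α} {Y : Ω → β} (hX : FiberMeasurable X)
    (hY : FiberMeasurable Y) : FiberMeasurable fun ω => (X ω, Y ω) := by
  rintro ⟨a, b⟩
  convert! (hX a).inter (hY b) using 1
  ext ω
  simp

theorem FiberMeasurable.pi {ι : Type*} [Finite ι] {X : ι → Ω → α}
    (hX : ∀ i, FiberMeasurable (X i)) : FiberMeasurable fun ω i => X i ω := by
  intro a
  convert! MeasurableSet.iInter fun i => hX i (a i) using 1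
  ext ω
  simp [funext_iff]

theorem FiberMeasurable.comp_measurable {Ω' : Type*} [MeasurableSpace Ω'] {X : Ω → α}
    (hX : FiberMeasurable X) {θ : Ω' → Ω} (hθ : Measurable θ) :
    FiberMeasurable fun ω => X (θ ω) := fun a => hθ (hX a)

/-- The Shannon entropy of the law of a function with finitely many values. -/
noncomputable def entropyOf [Fintype α] (ν : Measure Ω) (X : Ω → α) : ℝ :=
  ∑ a, Real.negMulLog (ν.real (X ⁻¹' {a}))

theorem entropyOf_comp_measurePreserving [Fintype α] {ν : Measure Ω} {X : Ω → α} {Ω' : Type*} [MeasurableSpace Ω'] {ν' : Measure Ω'}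
    {θ : Ω' → Ω} (hθ : MeasurePreserving θ ν' ν) (hX : FiberMeasurable X) :
    entropyOf ν' (fun ω => X (θ ω)) = entropyOf ν X := by
  refine Finset.sum_congr rfl fun a _ => ?_
  congr 1
  exact hθ.measureReal_preimage (hX a).nullMeasurableSet

theorem Real.negMulLog_sum_le {ι : Type*} (s : Finset ι) (p : ι → ℝ) (hp : ∀ i ∈ s, 0 ≤ p i) :
    Real.negMulLog (∑ i ∈ s, p i) ≤ ∑ i ∈ s, Real.negMulLog (p i) := by
  have h1 : Real.negMulLog (∑ i ∈ s, p i) = ∑ i ∈ s, -(p i * Real.log (∑ i ∈ s, p i)) := by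
    rw [Real.negMulLog, Finset.sum_neg_distrib, ← Finset.sum_mul, neg_mul]
  rw [h1]
  refine Finset.sum_le_sum fun i hi => ?_
  rw [Real.negMulLog, neg_mul, neg_le_neg_iff]
  rcases (hp i hi).eq_or_lt with h | h
  · simp [← h]
  · exact mul_le_mul_of_nonneg_left
      (Real.log_le_log h (Finset.single_le_sum hp hi)) h.le

variable {ν : Measure Ω} [IsProbabilityMeasure ν]
  {X : Ω → α} {Y : Ω → β} {Z : Ω → γ} {W : Ω → δ}

theorem measureReal_eq_sum_fiber (hX : FiberMeasurable X) {A : Set Ω} (hA : MeasurableSet A)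
    (s : Finset α) (hs : ∀ ω, ω ∈ A → X ω ∈ s) :
    ν.real A = ∑ a ∈ s, ν.real (A ∩ X ⁻¹' {a}) := by
  rw [← measureReal_biUnion_finset]
  · congr 1
    ext ω
    simp only [Set.mem_iUnion, Set.mem_inter_iff, Set.mem_preimage, Set.mem_singleton_iff,
      exists_prop]
    constructor
    · intro h
      exact ⟨X ω, hs ω h, h, rfl⟩
    · rintro ⟨_, _, h, _⟩
      exact h
  · intro a _ b _ hab
    refine Set.disjoint_left.mpr fun ω h1 h2 => hab ?_
    exact (h1.2 : X ω = a).symm.trans h2.2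
  · exact fun a _ => hA.inter (hX a)

variable [Fintype α]

theorem measureReal_fiber_eq_sum (hX : FiberMeasurable X) (hY : FiberMeasurable Y) (b : β) :
    ν.real (Y ⁻¹' {b}) = ∑ a, ν.real ((fun ω => (X ω, Y ω)) ⁻¹' {(a, b)}) := by
  rw [measureReal_eq_sum_fiber hX (hY b) Finset.univ (by simp)]
  refine Finset.sum_congr rfl fun a _ => ?_
  congr 1
  ext ω
  simp [and_comm]

theorem sum_measureReal_fiber (hX : FiberMeasurable X) : ∑ a, ν.real (X ⁻¹' {a}) = 1 := by
  have := measureReal_eq_sum_fiber (ν := ν) hX MeasurableSet.univ Finset.univ (by simp)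
  simpa using this.symm

variable [Fintype β] [Fintype γ] [Fintype δ]

theorem entropyOf_le_of_factorsThrough (hX : FiberMeasurable X) (hY : Y.FactorsThrough X) :
    entropyOf ν Y ≤ entropyOf ν X := by
  classical
  have hΩ : Nonempty Ω := nonempty_of_isProbabilityMeasure ν
  have : Nonempty β := hΩ.map Y
  have hYm := hX.of_factorsThrough hY
  obtain ⟨g, rfl⟩ := (Function.factorsThrough_iff Y).mp hY
  rw [entropyOf, entropyOf, ← Finset.sum_fiberwise Finset.univ g]
  refine Finset.sum_le_sum fun b _ => ?_
  have h1 := measureReal_eq_sum_fiber (ν := ν) hX (hYm b) (Finset.univ.filter fun a => g a = b)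
    (by simp)
  have h2 : ∀ a ∈ Finset.univ.filter (fun a => g a = b),
      ν.real (g ∘ X ⁻¹' {b} ∩ X ⁻¹' {a}) = ν.real (X ⁻¹' {a}) := by
    intro a ha
    congr 1
    ext ω
    simp only [Finset.mem_filter, Finset.mem_univ, true_and] at ha
    simp only [Set.mem_inter_iff, Set.mem_preimage, Function.comp_apply, Set.mem_singleton_iff,
      and_iff_right_iff_imp]
    rintro rfl
    exact ha
  rw [h1, Finset.sum_congr rfl h2]
  exact Real.negMulLog_sum_le _ _ fun _ _ => measureReal_nonneg

theorem entropyOf_eq_of_factorsThrough (hX : FiberMeasurable X) (hYX : Y.FactorsThrough X)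
    (hXY : X.FactorsThrough Y) : entropyOf ν Y = entropyOf ν X :=
  (entropyOf_le_of_factorsThrough hX hYX).antisymm
    (entropyOf_le_of_factorsThrough (hX.of_factorsThrough hYX) hXY)

theorem Real.mul_log_ratio_ge {p a b c : ℝ} (hp : 0 ≤ p) (hpa : p ≤ a) (hpb : p ≤ b)
    (hac : a ≤ c) :
    p - a * b / c ≤ p * Real.log p + p * Real.log c - p * Real.log a - p * Real.log b := by
  rcases hp.eq_or_lt with rfl | hp
  · have : 0 ≤ a * b / c := div_nonneg (mul_nonneg hpa hpb) (hpa.trans hac)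
    simpa using this
  · have ha := hp.trans_le hpa
    have hb := hp.trans_le hpb
    have hc := ha.trans_le hac
    have h1 := Real.log_le_sub_one_of_pos (x := a * b / (p * c)) (by positivity)
    rw [Real.log_div (by positivity) (by positivity), Real.log_mul ha.ne' hb.ne',
      Real.log_mul hp.ne' hc.ne'] at h1
    have h2 := mul_le_mul_of_nonneg_left h1 hp.le
    have h3 : p * (a * b / (p * c) - 1) = a * b / c - p := by field_simp
    rw [h3] at h2
    linarith

/-- Submodularity of entropy for an array of non-negative numbers. -/
theorem Real.negMulLog_submodular (p : α → β → γ → ℝ) (hp : ∀ x y z, 0 ≤ p x y z) :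
    ∑ x, ∑ y, ∑ z, Real.negMulLog (p x y z) + ∑ z, Real.negMulLog (∑ x, ∑ y, p x y z) ≤
      ∑ x, ∑ z, Real.negMulLog (∑ y, p x y z) + ∑ y, ∑ z, Real.negMulLog (∑ x, p x y z) := by
  set a : α → γ → ℝ := fun x z => ∑ y, p x y z with ha
  set b : β → γ → ℝ := fun y z => ∑ x, p x y z with hb
  set c : γ → ℝ := fun z => ∑ x, ∑ y, p x y z with hc
  have hca : ∀ z, c z = ∑ x, a x z := fun z => rfl
  have hcb : ∀ z, c z = ∑ y, b y z := fun z => Finset.sum_comm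
  have ha0 : ∀ x z, 0 ≤ a x z := fun x z => Finset.sum_nonneg fun y _ => hp x y z
  have hpt : ∀ x y z, p x y z - a x z * b y z / c z ≤ p x y z * Real.log (p x y z) +
      p x y z * Real.log (c z) - p x y z * Real.log (a x z) - p x y z * Real.log (b y z) := by
    intro x y z
    refine Real.mul_log_ratio_ge (hp x y z) ?_ ?_ ?_
    · exact Finset.single_le_sum (f := fun y => p x y z) (fun y _ => hp x y z) (Finset.mem_univ y)
    · exact Finset.single_le_sum (f := fun x => p x y z) (fun x _ => hp x y z) (Finset.mem_univ x)
    · rw [hca]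
      exact Finset.single_le_sum (f := fun x => a x z) (fun x _ => ha0 x z) (Finset.mem_univ x)
  have hsum := Finset.sum_le_sum fun x (_ : x ∈ Finset.univ) =>
    Finset.sum_le_sum fun y (_ : y ∈ Finset.univ) =>
      Finset.sum_le_sum fun z (_ : z ∈ Finset.univ) => hpt x y z
  simp only [Finset.sum_sub_distrib, Finset.sum_add_distrib] at hsum
  have swap : ∀ F : α → β → γ → ℝ, ∑ x, ∑ y, ∑ z, F x y z = ∑ z, ∑ x, ∑ y, F x y z := by
    intro F
    rw [Finset.sum_comm (s := (Finset.univ : Finset γ)) (t := (Finset.univ : Finset α))]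
    exact Finset.sum_congr rfl fun x _ => Finset.sum_comm
  have e0 : ∑ x, ∑ y, ∑ z, a x z * b y z / c z = ∑ x, ∑ y, ∑ z, p x y z := by
    have l1 : ∑ x, ∑ y, ∑ z, a x z * b y z / c z = ∑ z, c z := by
      have : ∀ z, ∑ x, ∑ y, a x z * b y z / c z = c z := by
        intro z
        simp_rw [← Finset.sum_div, ← Finset.sum_mul_sum]
        rw [← hca z, ← hcb z]
        rcases eq_or_ne (c z) 0 with h | h
        · simp [h]
        · field_simp
      rw [swap]
      exact Finset.sum_congr rfl fun z _ => this z
    rw [l1, swap]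
  have e1 : ∑ x, ∑ y, ∑ z, p x y z * Real.log (c z) = ∑ z, c z * Real.log (c z) := by
    rw [swap]
    simp only [hc, Finset.sum_mul]
  have e2 : ∑ x, ∑ y, ∑ z, p x y z * Real.log (a x z) = ∑ x, ∑ z, a x z * Real.log (a x z) := by
    refine Finset.sum_congr rfl fun x _ => ?_
    rw [Finset.sum_comm]
    exact Finset.sum_congr rfl fun z _ => by simp only [ha, Finset.sum_mul]
  have e3 : ∑ x, ∑ y, ∑ z, p x y z * Real.log (b y z) = ∑ y, ∑ z, b y z * Real.log (b y z) := by
    rw [Finset.sum_comm]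
    refine Finset.sum_congr rfl fun y _ => ?_
    rw [Finset.sum_comm]
    exact Finset.sum_congr rfl fun z _ => by simp only [hb, Finset.sum_mul]
  rw [e0, e1, e2, e3] at hsum
  simp only [Real.negMulLog, neg_mul, Finset.sum_neg_distrib]
  linarith

theorem entropyOf_prod_submodular (hX : FiberMeasurable X) (hY : FiberMeasurable Y)
    (hZ : FiberMeasurable Z) :
    entropyOf ν (fun ω => (X ω, Y ω, Z ω)) + entropyOf ν Z ≤
      entropyOf ν (fun ω => (X ω, Z ω)) + entropyOf ν (fun ω => (Y ω, Z ω)) := by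
  have key := Real.negMulLog_submodular
    (fun x y z => ν.real ((fun ω => (X ω, Y ω, Z ω)) ⁻¹' {(x, y, z)}))
    (fun _ _ _ => measureReal_nonneg)
  have h1 : ∀ y z, ∑ x, ν.real ((fun ω => (X ω, Y ω, Z ω)) ⁻¹' {(x, y, z)}) =
      ν.real ((fun ω => (Y ω, Z ω)) ⁻¹' {(y, z)}) := fun y z =>
    (measureReal_fiber_eq_sum hX (hY.prodMk hZ) (y, z)).symm
  have h2 : ∀ x z, ∑ y, ν.real ((fun ω => (X ω, Y ω, Z ω)) ⁻¹' {(x, y, z)}) =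
      ν.real ((fun ω => (X ω, Z ω)) ⁻¹' {(x, z)}) := by
    intro x z
    rw [measureReal_fiber_eq_sum hY (hX.prodMk hZ) (x, z)]
    refine Finset.sum_congr rfl fun y _ => ?_
    congr 1
    ext ω
    simp only [Set.mem_preimage, Set.mem_singleton_iff, Prod.mk.injEq]
    tauto
  have h3 : ∀ z, ∑ x, ν.real ((fun ω => (X ω, Z ω)) ⁻¹' {(x, z)}) = ν.real (Z ⁻¹' {z}) :=
    fun z => (measureReal_fiber_eq_sum hX hZ z).symm
  simp only [h1, h2, h3] at key
  simpa only [entropyOf, Fintype.sum_prod_type] using key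

/-- Submodularity of entropy. -/
theorem entropyOf_submodular (hX : FiberMeasurable X) (hY : FiberMeasurable Y)
    (hZX : Z.FactorsThrough X) (hZY : Z.FactorsThrough Y)
    (hW : W.FactorsThrough fun ω => (X ω, Y ω)) :
    entropyOf ν W + entropyOf ν Z ≤ entropyOf ν X + entropyOf ν Y := by
  have hZ := hX.of_factorsThrough hZX
  have h1 := entropyOf_prod_submodular (ν := ν) hX hY hZ
  have h2 : entropyOf ν W ≤ entropyOf ν (fun ω => (X ω, Y ω, Z ω)) :=
    entropyOf_le_of_factorsThrough (hX.prodMk (hY.prodMk hZ)) fun ω ω' h => hW (by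
      simp only [Prod.mk.injEq] at h ⊢
      exact ⟨h.1, h.2.1⟩)
  have h3 : entropyOf ν (fun ω => (X ω, Z ω)) ≤ entropyOf ν X :=
    entropyOf_le_of_factorsThrough hX fun ω ω' h => Prod.ext h (hZX h)
  have h4 : entropyOf ν (fun ω => (Y ω, Z ω)) ≤ entropyOf ν Y :=
    entropyOf_le_of_factorsThrough hY fun ω ω' h => Prod.ext h (hZY h)
  linarith

theorem entropyOf_prod_of_indep (hX : FiberMeasurable X) (hY : FiberMeasurable Y)
    (hXY : ∀ x y, ν.real (X ⁻¹' {x} ∩ Y ⁻¹' {y}) = ν.real (X ⁻¹' {x}) * ν.real (Y ⁻¹' {y})) :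
    entropyOf ν (fun ω => (X ω, Y ω)) = entropyOf ν X + entropyOf ν Y := by
  have h1 : ∀ x y, ν.real ((fun ω => (X ω, Y ω)) ⁻¹' {(x, y)}) =
      ν.real (X ⁻¹' {x}) * ν.real (Y ⁻¹' {y}) := by
    intro x y
    rw [← hXY]
    congr 1
    ext ω
    simp
  simp only [entropyOf, Fintype.sum_prod_type, h1, Real.negMulLog_mul, Finset.sum_add_distrib,
    ← Finset.sum_mul, ← Finset.mul_sum, sum_measureReal_fiber hX, sum_measureReal_fiber hY, one_mul]

theorem tendsto_entropyOf {X' : ℕ → Ω → α}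
    (h : Filter.Tendsto (fun n => ν.real {ω | X' n ω ≠ X ω}) Filter.atTop (nhds 0)) :
    Filter.Tendsto (fun n => entropyOf ν (X' n)) Filter.atTop (nhds (entropyOf ν X)) := by
  refine tendsto_finsetSum _ fun a _ => (Real.continuous_negMulLog.tendsto _).comp ?_
  rw [tendsto_iff_dist_tendsto_zero]
  refine squeeze_zero (fun _ => dist_nonneg) (fun n => ?_) h
  have h1 : ν.real (X' n ⁻¹' {a}) ≤ ν.real (X ⁻¹' {a}) + ν.real {ω | X' n ω ≠ X ω} := by
    refine (measureReal_mono ?_).trans (measureReal_union_le _ _)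
    intro ω hω
    by_cases hne : X' n ω = X ω
    · exact Or.inl (hne.symm.trans hω)
    · exact Or.inr hne
  have h2 : ν.real (X ⁻¹' {a}) ≤ ν.real (X' n ⁻¹' {a}) + ν.real {ω | X' n ω ≠ X ω} := by
    refine (measureReal_mono ?_).trans (measureReal_union_le _ _)
    intro ω hω
    by_cases hne : X' n ω = X ω
    · exact Or.inl (hne.trans hω)
    · exact Or.inr hne
  rw [Real.dist_eq, abs_sub_le_iff]
  constructor <;> linarith

end Entropy

section IID

variable {V 𝓧 K : Type*} [MeasurableSpace 𝓧] {ρ : Measure 𝓧} [IsProbabilityMeasure ρ]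
  [Fintype K] [MeasurableSpace K] [MeasurableSingletonClass K]

theorem entropyOf_infinitePi [DecidableEq V] {q : 𝓧 → K} (hq : Measurable q) (B : Finset V) :
    entropyOf (Measure.infinitePi fun _ : V => ρ) (fun ω (v : B) => q (ω v)) =
      B.card * entropyOf ρ q := by
  have hqm : ∀ v : V, FiberMeasurable fun ω : V → 𝓧 => q (ω v) := fun v a =>
    (hq.comp (measurable_pi_apply v)) (measurableSet_singleton a)
  have hpi : ∀ S : Finset V, FiberMeasurable fun (ω : V → 𝓧) (v : S) => q (ω v) :=
    fun S => FiberMeasurable.pi fun v => hqm v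
  induction B using Finset.induction_on with
  | empty =>
    simp only [Finset.card_empty, Nat.cast_zero, zero_mul]
    have : ∀ a : (∅ : Finset V) → K,
        (fun (ω : V → 𝓧) (v : (∅ : Finset V)) => q (ω v)) ⁻¹' {a} = Set.univ := fun a =>
      Set.eq_univ_of_forall fun ω => Subsingleton.elim _ _
    simp [entropyOf, this]
  | insert b B hb ih =>
    have hind := (ProbabilityTheory.iIndepFun_infinitePi (P := fun _ : V => ρ)
      (X := fun _ => q) (fun _ => hq)).indepFun_finset {b} B (by simpa using hb)
      (fun v => hq.comp (measurable_pi_apply v))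
    have h1 := entropyOf_prod_of_indep (ν := Measure.infinitePi fun _ : V => ρ)
      (hpi {b}) (hpi B) fun x y => by
        have := hind.measure_inter_preimage_eq_mul {x} {y} (measurableSet_singleton x)
          (measurableSet_singleton y)
        simp only [Measure.real, this, ENNReal.toReal_mul]
    have h2 : entropyOf (Measure.infinitePi fun _ : V => ρ)
        (fun (ω : V → 𝓧) (v : ({b} : Finset V)) => q (ω v)) = entropyOf ρ q := by
      rw [entropyOf_eq_of_factorsThrough (hqm b)]
      · exact entropyOf_comp_measurePreserving
          (measurePreserving_eval_infinitePi (fun _ : V => ρ) b)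
          fun a => hq (measurableSet_singleton a)
      · intro ω ω' h
        funext ⟨v, hv⟩
        rw [Finset.mem_singleton] at hv
        subst hv
        exact h
      · intro ω ω' h
        exact congrFun h ⟨b, Finset.mem_singleton_self b⟩
    rw [entropyOf_eq_of_factorsThrough ((hpi {b}).prodMk (hpi B)), h1, h2, ih,
      Finset.card_insert_of_notMem hb]
    · push_cast; ring
    · intro ω ω' h
      simp only [Prod.mk.injEq] at h
      funext ⟨v, hv⟩
      rcases Finset.mem_insert.mp hv with rfl | hv
      · exact congrFun h.1 ⟨v, Finset.mem_singleton_self v⟩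
      · exact congrFun h.2 ⟨v, hv⟩
    · intro ω ω' h
      refine Prod.ext ?_ ?_
      · funext ⟨v, hv⟩
        exact congrFun h ⟨v, Finset.mem_insert.mpr (Or.inl (Finset.mem_singleton.mp hv))⟩
      · funext ⟨v, hv⟩
        exact congrFun h ⟨v, Finset.mem_insert_of_mem hv⟩

end IID

section Approximation

variable {V 𝓧 N : Type*}

/-- `g` depends only on whether the coordinates in `S` belong to the sets in `𝓔`. -/
def DependsOnFinite (S : Finset V) (𝓔 : Finset (Set 𝓧)) (g : (V → 𝓧) → N) : Prop :=
  ∀ ω ω', (∀ v ∈ S, ∀ E ∈ 𝓔, ω v ∈ E ↔ ω' v ∈ E) → g ω = g ω'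

theorem DependsOnFinite.mono {S S' : Finset V} {𝓔 𝓔' : Finset (Set 𝓧)} {g : (V → 𝓧) → N}
    (hg : DependsOnFinite S 𝓔 g) (hS : S ⊆ S') (h𝓔 : 𝓔 ⊆ 𝓔') : DependsOnFinite S' 𝓔' g :=
  fun _ _ h => hg _ _ fun v hv E hE => h v (hS hv) E (h𝓔 hE)

theorem DependsOnFinite.factorsThrough {S : Finset V} {𝓔 : Finset (Set 𝓧)} {g : (V → 𝓧) → N}
    (hg : DependsOnFinite S 𝓔 g) :
    g.FactorsThrough fun ω (v : S) (E : 𝓔) => ω v ∈ (E : Set 𝓧) := fun ω ω' h =>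
  hg ω ω' fun v hv E hE => by
    have := congrFun (congrFun h ⟨v, hv⟩) ⟨E, hE⟩
    exact iff_of_eq this

variable [MeasurableSpace 𝓧]

theorem measurable_membership {𝓔 : Finset (Set 𝓧)} (h𝓔 : ∀ E ∈ 𝓔, MeasurableSet E) :
    Measurable fun (x : 𝓧) (E : 𝓔) => x ∈ (E : Set 𝓧) :=
  measurable_pi_lambda _ fun E => measurableSet_setOfPred.mp (h𝓔 E E.2)

theorem DependsOnFinite.fiberMeasurable {S : Finset V} {𝓔 : Finset (Set 𝓧)} {g : (V → 𝓧) → N}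
    (hg : DependsOnFinite S 𝓔 g) (h𝓔 : ∀ E ∈ 𝓔, MeasurableSet E) : FiberMeasurable g := by
  refine FiberMeasurable.of_factorsThrough (FiberMeasurable.pi fun v => ?_) hg.factorsThrough
  exact fun a => ((measurable_membership h𝓔).comp (measurable_pi_apply (v : V)))
    (measurableSet_singleton a)

/-- The sets that are determined by finitely many coordinates through finitely many sets. -/
def finitelyDetermined (V 𝓧 : Type*) [MeasurableSpace 𝓧] : Set (Set (V → 𝓧)) :=
  {A | ∃ (S : Finset V) (𝓔 : Finset (Set 𝓧)), (∀ E ∈ 𝓔, MeasurableSet E) ∧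
    DependsOnFinite S 𝓔 fun ω => ω ∈ A}

theorem isSetAlgebra_finitelyDetermined : IsSetAlgebra (finitelyDetermined V 𝓧) := by
  classical
  constructor
  · exact ⟨∅, ∅, by simp, fun _ _ _ => by simp⟩
  · rintro A ⟨S, 𝓔, h𝓔, hA⟩
    refine ⟨S, 𝓔, h𝓔, fun ω ω' h => ?_⟩
    have := hA ω ω' h
    simp only at this
    simp only [Set.mem_compl_iff, this]
  · rintro A B ⟨S, 𝓔, h𝓔, hA⟩ ⟨S', 𝓔', h𝓔', hB⟩
    refine ⟨S ∪ S', 𝓔 ∪ 𝓔', ?_, fun ω ω' h => ?_⟩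
    · intro E hE
      rcases Finset.mem_union.mp hE with hE | hE
      exacts [h𝓔 E hE, h𝓔' E hE]
    · have h1 := hA.mono Finset.subset_union_left Finset.subset_union_left ω ω' h
      have h2 := hB.mono Finset.subset_union_right Finset.subset_union_right ω ω' h
      simp only at h1 h2
      simp only [Set.mem_union, h1, h2]

theorem measurableSet_of_mem_finitelyDetermined {A : Set (V → 𝓧)}
    (hA : A ∈ finitelyDetermined V 𝓧) : MeasurableSet A := by
  obtain ⟨S, 𝓔, h𝓔, hA⟩ := hA
  have := hA.fiberMeasurable h𝓔 True
  convert! this using 1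
  ext ω
  simp

theorem measureDense_finitelyDetermined (ν : Measure (V → 𝓧)) [IsFiniteMeasure ν] :
    ν.MeasureDense (finitelyDetermined V 𝓧) := by
  refine Measure.MeasureDense.of_generateFrom_isSetAlgebra_finite ν
    isSetAlgebra_finitelyDetermined (le_antisymm ?_ ?_)
  · refine iSup_le fun v => ?_
    rintro _ ⟨E, hE, rfl⟩
    refine MeasurableSpace.measurableSet_generateFrom ⟨{v}, {E}, by simpa using hE, ?_⟩
    intro ω ω' h
    exact propext (h v (by simp) E (by simp))
  · exact MeasurableSpace.generateFrom_le fun A hA => measurableSet_of_mem_finitelyDetermined hA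

theorem exists_dependsOnFinite_measure_ne_lt [Fintype N] [Nonempty N] (ν : Measure (V → 𝓧))
    [IsFiniteMeasure ν] {g : (V → 𝓧) → N} (hg : FiberMeasurable g) {ε : ℝ} (hε : 0 < ε) :
    ∃ (S : Finset V) (𝓔 : Finset (Set 𝓧)) (g' : (V → 𝓧) → N), (∀ E ∈ 𝓔, MeasurableSet E) ∧
      DependsOnFinite S 𝓔 g' ∧ ν.real {ω | g' ω ≠ g ω} ≤ ε := by
  classical
  have hcard : (0 : ℝ) < Fintype.card N := by exact_mod_cast Fintype.card_pos
  choose A hA hAε using fun m : N => (measureDense_finitelyDetermined ν).approx (g ⁻¹' {m}) (hg m)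
    (measure_ne_top _ _) (ε / Fintype.card N) (by positivity)
  choose S 𝓔 h𝓔 hdep using hA
  let pick : Set N → N := fun s => if h : s.Nonempty then h.some else Classical.arbitrary N
  have hpick : ∀ m, pick {m} = m := by
    intro m
    have h : ({m} : Set N).Nonempty := Set.singleton_nonempty m
    simp only [pick, dif_pos h]
    exact h.some_mem
  refine ⟨Finset.univ.biUnion S, Finset.univ.biUnion 𝓔, fun ω => pick {m | ω ∈ A m}, ?_, ?_, ?_⟩
  · intro E hE
    obtain ⟨m, -, hE⟩ := Finset.mem_biUnion.mp hE
    exact h𝓔 m E hE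
  · intro ω ω' h
    have : ∀ m, (ω ∈ A m) = (ω' ∈ A m) := fun m =>
      (hdep m).mono (Finset.subset_biUnion_of_mem S (Finset.mem_univ m))
        (Finset.subset_biUnion_of_mem 𝓔 (Finset.mem_univ m)) ω ω' h
    simp only [this]
  · have hsub : {ω | pick {m | ω ∈ A m} ≠ g ω} ⊆
        ⋃ m ∈ (Finset.univ : Finset N), symmDiff (g ⁻¹' {m}) (A m) := by
      intro ω hω
      by_contra hcon
      refine hω ?_
      have : {m | ω ∈ A m} = {g ω} := by
        ext m
        simp only [Finset.mem_univ, Set.iUnion_true, Set.mem_iUnion, not_exists,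
          Set.mem_symmDiff, Set.mem_preimage, Set.mem_singleton_iff] at hcon
        have := hcon m
        change ω ∈ A m ↔ m = g ω
        constructor
        · intro h; by_contra h'; exact this (Or.inr ⟨h, fun h2 => h' h2.symm⟩)
        · intro h; by_contra h'; exact this (Or.inl ⟨h.symm, h'⟩)
      rw [this, hpick]
    refine (measureReal_mono hsub (measure_ne_top _ _)).trans ((measureReal_biUnion_finset_le _ _).trans ?_)
    have : ∀ m ∈ (Finset.univ : Finset N), ν.real (symmDiff (g ⁻¹' {m}) (A m)) ≤
        ε / Fintype.card N := fun m _ =>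
      ENNReal.toReal_le_of_le_ofReal (by positivity) (hAε m).le
    refine (Finset.sum_le_sum this).trans_eq ?_
    rw [Finset.sum_const, Finset.card_univ, nsmul_eq_mul]
    field_simp

end Approximation

section ProcessEntropy

open scoped Pointwise

variable {V 𝓧 ι β N K : Type*} [MulAction (FreeGroup ι) V]

/-- The joint states of a factor process, with local rule `g`, at the elements of `S` and of the
discretized labels of the vertices `γ • base b` with `γ ∈ C`. -/
def blockStates (base : β → V) (q : 𝓧 → K) (g : (V → 𝓧) → N) (S C : Finset (FreeGroup ι))
    (ω : V → 𝓧) : (S → N) × (C → β → K) :=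
  (fun γ => g fun v => ω ((γ : FreeGroup ι) • v), fun γ b => q (ω ((γ : FreeGroup ι) • base b)))

theorem blockStates_eq_iff {base : β → V} {q : 𝓧 → K} {g : (V → 𝓧) → N}
    {S C : Finset (FreeGroup ι)} {ω ω' : V → 𝓧} :
    blockStates base q g S C ω = blockStates base q g S C ω' ↔
      (∀ γ ∈ S, (g fun v => ω (γ • v)) = g fun v => ω' (γ • v)) ∧
      ∀ γ ∈ C, ∀ b, q (ω (γ • base b)) = q (ω' (γ • base b)) := by
  simp only [blockStates, Prod.mk.injEq, funext_iff, Subtype.forall]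

variable [MeasurableSpace 𝓧] {κ : Measure 𝓧} [IsProbabilityMeasure κ]

theorem measurePreserving_comp_infinitePi (e : V ≃ V) :
    MeasurePreserving (fun (ω : V → 𝓧) v => ω (e v))
      (Measure.infinitePi fun _ : V => κ) (Measure.infinitePi fun _ : V => κ) :=
  ⟨measurable_pi_lambda _ fun v => measurable_pi_apply (e v),
    Measure.map_infinitePi_infinitePi_of_inj (P := fun _ : V => κ) e.injective⟩

section BlockStates

variable {base : β → V} {q : 𝓧 → K} {g : (V → 𝓧) → N}

variable [MeasurableSpace K] [MeasurableSingletonClass K]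

theorem fiberMeasurable_blockStates [Finite β] (hq : Measurable q) (hg : FiberMeasurable g)
    (S C : Finset (FreeGroup ι)) : FiberMeasurable (blockStates base q g S C) := by
  refine FiberMeasurable.prodMk (FiberMeasurable.pi fun γ => ?_)
    (FiberMeasurable.pi fun γ => FiberMeasurable.pi fun b => ?_)
  · exact hg.comp_measurable (measurable_pi_lambda _ fun v => measurable_pi_apply _)
  · exact fun a => (hq.comp (measurable_pi_apply _)) (measurableSet_singleton a)

variable [Fintype β] [Fintype N] [Fintype K] [DecidableEq ι]

open Classical in
theorem isFiniteFactorEntropy_blockStates (hq : Measurable q) (hg : FiberMeasurable g)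
    (hbase : Function.Bijective fun p : FreeGroup ι × β => p.1 • base p.2) (B : Finset V)
    (hB : ∀ ω ω' : V → 𝓧, (∀ v ∈ B, q (ω v) = q (ω' v)) → g ω = g ω') :
    IsFiniteFactorEntropy
      (fun S C : Finset (FreeGroup ι) =>
        entropyOf (Measure.infinitePi fun _ : V => κ) (blockStates base q g S C))
      (Fintype.card β * entropyOf κ q) where
  mono {S S' C C'} hS hC := by
    refine entropyOf_le_of_factorsThrough (fiberMeasurable_blockStates hq hg _ _)
      fun ω ω' h => ?_
    rw [blockStates_eq_iff] at h ⊢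
    exact ⟨fun γ hγ => h.1 γ (hS hγ), fun γ hγ => h.2 γ (hC hγ)⟩
  submod S S' C C' := by
    refine entropyOf_submodular (fiberMeasurable_blockStates hq hg _ _)
      (fiberMeasurable_blockStates hq hg _ _) (fun ω ω' h => ?_) (fun ω ω' h => ?_)
      (fun ω ω' h => ?_)
    · rw [blockStates_eq_iff] at h ⊢
      exact ⟨fun γ hγ => h.1 γ (Finset.mem_inter.mp hγ).1,
        fun γ hγ => h.2 γ (Finset.mem_inter.mp hγ).1⟩
    · rw [blockStates_eq_iff] at h ⊢
      exact ⟨fun γ hγ => h.1 γ (Finset.mem_inter.mp hγ).2,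
        fun γ hγ => h.2 γ (Finset.mem_inter.mp hγ).2⟩
    · simp only [Prod.mk.injEq] at h
      rw [blockStates_eq_iff, blockStates_eq_iff] at h
      rw [blockStates_eq_iff]
      exact ⟨fun γ hγ => (Finset.mem_union.mp hγ).elim (h.1.1 γ) (h.2.1 γ),
        fun γ hγ => (Finset.mem_union.mp hγ).elim (h.1.2 γ) (h.2.2 γ)⟩
  inv γ₀ S C := by
    have h1 := entropyOf_comp_measurePreserving
      (measurePreserving_comp_infinitePi (κ := κ) (MulAction.toPerm γ₀ : Equiv.Perm V))
      (fiberMeasurable_blockStates (base := base) hq hg S C)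
    rw [← h1]
    have h2 : ∀ ω ω' : V → 𝓧, (blockStates base q g S C
        (fun v => ω ((MulAction.toPerm γ₀ : Equiv.Perm V) v)) =
        blockStates base q g S C (fun v => ω' ((MulAction.toPerm γ₀ : Equiv.Perm V) v))) ↔
        blockStates base q g (γ₀ • S) (γ₀ • C) ω = blockStates base q g (γ₀ • S) (γ₀ • C) ω' := by
      intro ω ω'
      simp only [blockStates_eq_iff, Finset.smul_finset_def, Finset.forall_mem_image, MulAction.toPerm_apply,
        smul_eq_mul, mul_smul]
    refine entropyOf_eq_of_factorsThrough ?_ (fun ω ω' h => (h2 ω ω').mp h)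
      (fun ω ω' h => (h2 ω ω').mpr h)
    exact (fiberMeasurable_blockStates hq hg S C).comp_measurable
      (measurePreserving_comp_infinitePi (κ := κ) (MulAction.toPerm γ₀ : Equiv.Perm V)).measurable
  empty_left C := by
    let D : Finset V := (C ×ˢ (Finset.univ : Finset β)).image fun p => p.1 • base p.2
    have hD : D.card = C.card * Fintype.card β := by
      rw [Finset.card_image_of_injective _ hbase.injective, Finset.card_product, Finset.card_univ]
    have h1 := entropyOf_infinitePi (ρ := κ) hq D
    rw [hD] at h1
    have h2 : ∀ ω ω' : V → 𝓧, blockStates base q g (∅ : Finset (FreeGroup ι)) C ω =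
        blockStates base q g ∅ C ω' ↔
        (fun v : D => q (ω v)) = fun v : D => q (ω' v) := by
      intro ω ω'
      rw [blockStates_eq_iff, funext_iff, Subtype.forall]
      simp only [D, Finset.forall_mem_image, Finset.mem_product, Finset.mem_univ, and_true,
        Prod.forall, Finset.notMem_empty, false_imp_iff, implies_true, true_and]
      exact ⟨fun h γ b hγ => h γ hγ b, fun h γ hγ b => h γ b hγ⟩
    rw [entropyOf_eq_of_factorsThrough (X := fun (ω : V → 𝓧) (v : D) => q (ω v))
      (FiberMeasurable.pi fun v a => (hq.comp (measurable_pi_apply _)) (measurableSet_singleton a))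
      (fun ω ω' h => (h2 ω ω').mpr h) (fun ω ω' h => (h2 ω ω').mp h), h1]
    push_cast
    ring
  determined := by
    choose p hp using hbase.surjective
    refine ⟨B.image fun v => (p v).1, fun C hC => ?_⟩
    refine entropyOf_le_of_factorsThrough (fiberMeasurable_blockStates hq hg _ _)
      fun ω ω' h => ?_
    rw [blockStates_eq_iff] at h ⊢
    refine ⟨fun γ hγ => ?_, h.2⟩
    rw [Finset.mem_singleton] at hγ
    subst hγ
    simp only [one_smul]
    refine hB ω ω' fun v hv => ?_
    have := h.2 (p v).1 (hC (Finset.mem_image_of_mem _ hv)) (p v).2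
    rwa [show (p v).1 • base (p v).2 = v from hp v] at this

end BlockStates

variable [Fintype ι] [Finite β] [Fintype N] {base : β → V}

theorem edge_vertex_inequality_of_dependsOnFinite
    (hbase : Function.Bijective fun p : FreeGroup ι × β => p.1 • base p.2)
    {g : (V → 𝓧) → N} {B : Finset V} {𝓔 : Finset (Set 𝓧)}
    (h𝓔 : ∀ E ∈ 𝓔, MeasurableSet E) (hg : DependsOnFinite B 𝓔 g) :
    (2 * Fintype.card ι - 1) * entropyOf (Measure.infinitePi fun _ : V => κ) g ≤
      ∑ i : ι, entropyOf (Measure.infinitePi fun _ : V => κ)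
        (fun ω => (g ω, g fun v => ω (FreeGroup.of i • v))) := by
  classical
  have := Fintype.ofFinite β
  have hgm := hg.fiberMeasurable h𝓔
  have hf := isFiniteFactorEntropy_blockStates (κ := κ) (measurable_membership h𝓔) hgm hbase B
    fun ω ω' h => hg ω ω' fun v hv E hE => iff_of_eq (congrFun (h v hv) ⟨E, hE⟩)
  have key := hf.edge_vertex_inequality
  have h1 : entropyOf (Measure.infinitePi fun _ : V => κ)
      (blockStates base (fun x (E : 𝓔) => x ∈ (E : Set 𝓧)) g ({1} : Finset (FreeGroup ι)) ∅) =
      entropyOf (Measure.infinitePi fun _ : V => κ) g := by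
    refine entropyOf_eq_of_factorsThrough hgm (fun ω ω' h => ?_) (fun ω ω' h => ?_)
    · rw [blockStates_eq_iff]
      simpa using h
    · rw [blockStates_eq_iff] at h
      simpa using h
  have h2 : ∀ i : ι, entropyOf (Measure.infinitePi fun _ : V => κ)
      (blockStates base (fun x (E : 𝓔) => x ∈ (E : Set 𝓧)) g {1, FreeGroup.of i} ∅) =
      entropyOf (Measure.infinitePi fun _ : V => κ)
        (fun ω => (g ω, g fun v => ω (FreeGroup.of i • v))) := by
    intro i
    refine entropyOf_eq_of_factorsThrough
      (hgm.prodMk (hgm.comp_measurable (measurable_pi_lambda _ fun v => measurable_pi_apply _)))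
      (fun ω ω' h => ?_) (fun ω ω' h => ?_)
    · rw [blockStates_eq_iff]
      simpa using h
    · rw [blockStates_eq_iff] at h
      simpa using h
  simpa only [h1, h2] using key

/-- The edge-vertex inequality for factors of IID under a free group: if the free group of rank
`r` acts on `V` freely with finitely many orbits, then the sum of the entropies of the `r` edges
at a vertex is at least `2r - 1` times the entropy of a vertex. -/
theorem edge_vertex_inequality_of_fiberMeasurable
    (hbase : Function.Bijective fun p : FreeGroup ι × β => p.1 • base p.2)
    {g : (V → 𝓧) → N} (hg : FiberMeasurable g) :
    (2 * Fintype.card ι - 1) * entropyOf (Measure.infinitePi fun _ : V => κ) g ≤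
      ∑ i : ι, entropyOf (Measure.infinitePi fun _ : V => κ)
        (fun ω => (g ω, g fun v => ω (FreeGroup.of i • v))) := by
  set ν := Measure.infinitePi fun _ : V => κ with hν
  have : Nonempty N := (nonempty_of_isProbabilityMeasure ν).map g
  choose B 𝓔 g' h𝓔 hdep hg' using fun n : ℕ =>
    exists_dependsOnFinite_measure_ne_lt ν hg (Nat.one_div_pos_of_nat (α := ℝ) (n := n))
  have hlim0 := tendsto_one_div_add_atTop_nhds_zero_nat (𝕜 := ℝ)
  have h1 : Filter.Tendsto (fun n => entropyOf ν (g' n)) Filter.atTop (nhds (entropyOf ν g)) :=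
    tendsto_entropyOf (squeeze_zero (fun _ => measureReal_nonneg) hg' hlim0)
  have h2 : ∀ i : ι, Filter.Tendsto
      (fun n => entropyOf ν (fun ω => (g' n ω, g' n fun v => ω (FreeGroup.of i • v))))
      Filter.atTop (nhds (entropyOf ν (fun ω => (g ω, g fun v => ω (FreeGroup.of i • v))))) := by
    intro i
    have hθ := measurePreserving_comp_infinitePi (κ := κ)
      (MulAction.toPerm (FreeGroup.of i) : Equiv.Perm V)
    have hlim1 := hlim0.add hlim0
    rw [add_zero] at hlim1
    refine tendsto_entropyOf (squeeze_zero (fun _ => measureReal_nonneg) (fun n => ?_) hlim1)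
    have hmeas : NullMeasurableSet {ω | g' n ω ≠ g ω} ν := by
      have h3 := ((hdep n).fiberMeasurable (h𝓔 n)).prodMk hg
      have h4 : FiberMeasurable fun ω => g' n ω ≠ g ω :=
        h3.of_factorsThrough fun ω ω' h => by
          simp only [Prod.mk.injEq] at h
          simp only [h.1, h.2]
      refine MeasurableSet.nullMeasurableSet ?_
      convert! h4 True using 1
      ext ω
      simp
    calc ν.real _ ≤ ν.real ({ω | g' n ω ≠ g ω} ∪
          (fun (ω : V → 𝓧) v => ω ((MulAction.toPerm (FreeGroup.of i) : Equiv.Perm V) v)) ⁻¹'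
            {ω | g' n ω ≠ g ω}) := by
          refine measureReal_mono (fun ω hω => ?_) (measure_ne_top _ _)
          by_contra hcon
          rw [Set.mem_union, not_or] at hcon
          exact hω (Prod.ext (not_not.mp hcon.1) (not_not.mp hcon.2))
      _ ≤ _ := (measureReal_union_le _ _).trans
          (add_le_add (hg' n) ((hθ.measureReal_preimage hmeas).trans_le (hg' n)))
  exact le_of_tendsto_of_tendsto' (h1.const_mul _) (tendsto_finsetSum _ fun i _ => h2 i)
    fun n => edge_vertex_inequality_of_dependsOnFinite hbase (h𝓔 n) (hdep n)

end ProcessEntropy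

section FactorOfIID

theorem IsAutFactor.apply_comp {V M : Type*} {T : SimpleGraph V} [MeasurableSpace M]
    {F : (V → unitInterval) → (V → M)} (hF : IsAutFactor T F) (φ : T ≃g T) (ω : V → unitInterval) (v : V) :
    F (fun w => ω (φ w)) v = F ω (φ v) :=
  congrFun (hF.equivariant φ.symm ω) v

variable {V M : Type*} {T : SimpleGraph V} [Fintype M] [MeasurableSpace M]
  [DiscreteMeasurableSpace M] {F : (V → unitInterval) → (V → M)}

theorem IsAutFactor.fiberMeasurable (hF : IsAutFactor T F) (v : V) :
    FiberMeasurable fun ω => F ω v := fun a =>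
  ((measurable_pi_apply v).comp hF.measurable) (measurableSet_singleton a)

instance (V : Type*) : IsProbabilityMeasure (uniformIID V) := by
  unfold uniformIID
  infer_instance

theorem IsAutFactor.jointEntropy_eq (hF : IsAutFactor T F) {α : Type*} [Fintype α]
    {X : (V → unitInterval) → α} (hX : FiberMeasurable X) (S : Finset V)
    (hSX : ∀ ω ω', (∀ v ∈ S, F ω v = F ω' v) ↔ X ω = X ω') :
    jointEntropy ((uniformIID V).map F) S = entropyOf (uniformIID V) X := by
  classical
  have hr : Measurable fun (y : V → M) (s : S) => y s :=
    measurable_pi_lambda _ fun s => measurable_pi_apply _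
  have h1 : jointEntropy ((uniformIID V).map F) S =
      entropyOf (uniformIID V) fun ω (s : S) => F ω s := by
    unfold jointEntropy shannonEntropy entropyOf
    rw [Measure.map_map hr hF.measurable]
    refine Finset.sum_congr (by congr!) fun a _ => ?_
    rw [map_measureReal_apply (hr.comp hF.measurable) (measurableSet_singleton a)]
    rfl
  have h2 : ∀ ω ω', (fun s : S => F ω s) = (fun s : S => F ω' s) ↔ X ω = X ω' := by
    intro ω ω'
    rw [← hSX, funext_iff, Subtype.forall]
  rw [h1]
  exact entropyOf_eq_of_factorsThrough hX (fun ω ω' h => (h2 ω ω').mpr h)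
    fun ω ω' h => (h2 ω ω').mp h

end FactorOfIID

theorem SimpleGraph.Walk.IsPath.exists_of_length_eq_three {V : Type*} {T : SimpleGraph V} {a b : V}
    {p : T.Walk a b} (hp : p.IsPath) (hlen : p.length = 3) :
    ∃ a₀ a₁ a₂ a₃, p.support = [a₀, a₁, a₂, a₃] ∧ T.Adj a₀ a₁ ∧ T.Adj a₁ a₂ ∧ T.Adj a₂ a₃ ∧
      [a₀, a₁, a₂, a₃].Nodup := by
  have hnd := hp.support_nodup
  match p, hlen, hnd with
  | .cons h₀ (.cons h₁ (.cons h₂ .nil)), _, hnd =>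
    exact ⟨_, _, _, _, rfl, h₀, h₁, h₂, hnd⟩

theorem mainTheorem5 {V M : Type*} [DecidableEq V]
    [Fintype M] [MeasurableSpace M] [DiscreteMeasurableSpace M]
    (d : ℕ) (hd : 3 ≤ d)
    (T : SimpleGraph V) [T.LocallyFinite] (hT : T.IsTree) (hreg : T.IsRegularOfDegree d)
    (μ : Measure (V → M)) (hμ : IsFactorOfIID T μ)
    {a b : V} (p : T.Walk a b) (hp : p.IsPath) (hlen : p.length = 3)
    {u v : V} (huv : T.Adj u v) :
    jointEntropy μ p.support.toFinset ≥
      (2 * (d : ℝ) - 3) / ((d : ℝ) - 1) * jointEntropy μ {u, v} := by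
  obtain ⟨F, hF, rfl⟩ := hμ
  obtain ⟨a₀, a₁, a₂, a₃, hsupp, ha₀, ha₁, ha₂, hnd⟩ := hp.exists_of_length_eq_three hlen
  obtain ⟨ρ, hρ, hadj⟩ := hT.exists_freeGroup_action hreg huv
  let _ : MulAction (FreeGroup (Fin (d - 1))) V :=
    { smul := fun γ w => ρ γ w
      one_smul := fun w => by change ρ 1 w = w; rw [map_one]; rfl
      mul_smul := fun γ γ' w => by change ρ (γ * γ') w = ρ γ (ρ γ' w); rw [map_mul]; rfl }
  have hX : FiberMeasurable fun ω => (F ω u, F ω v) :=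
    (hF.fiberMeasurable u).prodMk (hF.fiberMeasurable v)
  have hedge : jointEntropy ((uniformIID V).map F) {u, v} =
      entropyOf (uniformIID V) fun ω => (F ω u, F ω v) :=
    hF.jointEntropy_eq hX _ fun ω ω' => by simp
  have hpath : ∀ i : Fin (d - 1), entropyOf (uniformIID V) (fun ω => ((F ω u, F ω v),
      (fun ω => (F ω u, F ω v)) fun w => ω (FreeGroup.of i • w))) =
      jointEntropy ((uniformIID V).map F) p.support.toFinset := by
    intro i
    have hinj : ∀ (γ γ' : FreeGroup (Fin (d - 1))) (b c : Bool), γ ≠ γ' ∨ b ≠ c →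
        ρ γ (bif b then v else u) ≠ ρ γ' (bif c then v else u) := by
      intro γ γ' b c h heq
      have := hρ.1 (a₁ := (γ, b)) (a₂ := (γ', c)) heq
      simp only [Prod.mk.injEq] at this
      tauto
    have hne : (1 : FreeGroup (Fin (d - 1))) ≠ FreeGroup.of i := (FreeGroup.of_ne_one i).symm
    obtain ⟨φ, h₀, h₁, h₂, h₃⟩ := hT.exists_iso_of_path_three hreg
      (a₀ := v) (a₁ := u) (a₂ := ρ (FreeGroup.of i) v) (a₃ := ρ (FreeGroup.of i) u)
      huv.symm (hadj i) ((ρ (FreeGroup.of i)).map_adj_iff.mpr huv.symm) (by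
        have e1 := hinj 1 (FreeGroup.of i) true true (Or.inl hne)
        have e2 := hinj 1 (FreeGroup.of i) true false (Or.inl hne)
        have e3 := hinj 1 (FreeGroup.of i) false true (Or.inl hne)
        have e4 := hinj 1 (FreeGroup.of i) false false (Or.inl hne)
        simp only [map_one, RelIso.one_apply, cond_true, cond_false] at e1 e2 e3 e4
        simp [e1, e2, e3, e4, huv.ne'])
      ha₀ ha₁ ha₂ hnd
    have hpair := hX.prodMk (hX.comp_measurable (measurable_pi_lambda _ fun w =>
      measurable_pi_apply (FreeGroup.of i • w)))
    have hθ : MeasurePreserving (fun (ω : V → unitInterval) w => ω (φ.toEquiv w))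
        (uniformIID V) (uniformIID V) := measurePreserving_comp_infinitePi φ.toEquiv
    refine (entropyOf_comp_measurePreserving hθ hpair).symm.trans ?_
    refine (hF.jointEntropy_eq (hpair.comp_measurable hθ.measurable) _ fun ω ω' => ?_).symm
    have e1 : ∀ (ω : V → unitInterval) w, F (fun x => ω (φ.toEquiv x)) w = F ω (φ w) :=
      fun ω w => hF.apply_comp φ ω w
    have e2 : ∀ (ω : V → unitInterval) w, F (fun x => ω (FreeGroup.of i • x)) w =
      F ω (ρ (FreeGroup.of i) w) := fun ω w => hF.apply_comp (ρ (FreeGroup.of i)) ω w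
    rw [hsupp]
    simp only [List.mem_toFinset, List.mem_cons, List.not_mem_nil, or_false, forall_eq_or_imp,
      forall_eq, Prod.mk.injEq]
    rw [e2 fun x => ω (φ.toEquiv x), e2 fun x => ω (φ.toEquiv x), e2 fun x => ω' (φ.toEquiv x),
      e2 fun x => ω' (φ.toEquiv x)]
    simp only [e1, h₀, h₁, h₂, h₃]
    tauto
  have key := edge_vertex_inequality_of_fiberMeasurable
    (κ := (volume : Measure unitInterval)) (base := fun b : Bool => bif b then v else u) hρ hX
  have hd1 : ((d - 1 : ℕ) : ℝ) = d - 1 := by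
    rw [Nat.cast_sub (by omega)]
    simp
  have hd3 : (3 : ℝ) ≤ d := by exact_mod_cast hd
  have key' : (2 * (d : ℝ) - 3) * jointEntropy ((uniformIID V).map F) {u, v} ≤
      (d - 1) * jointEntropy ((uniformIID V).map F) p.support.toFinset := by
    have h1 := Finset.sum_congr rfl fun i (_ : i ∈ Finset.univ) => hpath i
    rw [Finset.sum_const, Finset.card_univ, nsmul_eq_mul, Fintype.card_fin, hd1] at h1
    rw [← h1, hedge]
    rw [Fintype.card_fin, hd1] at key
    refine le_trans (le_of_eq ?_) key
    change _ = _ * entropyOf (uniformIID V) _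
    ring
  rw [ge_iff_le, div_mul_eq_mul_div, div_le_iff₀ (by linarith)]
  linarith
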